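/- Let $\mathcal V$ be a bicomplete closed symmetric monoidal category with a cofibrantly generated model structure making it a symmetric monoidal model category (pushout-product axiom and unit axiom), and assume that the unit $\mathbb 1$ is cofibrant. Let $\mathcal C$ be a small category, let $\mathcal U=[\mathcal C^{\mathrm{op}},\mathcal V]$ be the $\mathcal V$-category of $\mathcal V$-valued presheaves on $\mathcal C$, with morphism objects the ends $\int_{c}[F(c),G(c)]$, and let $y:\mathcal C\to\mathcal U$ be the Yoneda embedding $y(c)=\coprod_{\mathcal C(\bullet,c)}\mathbb 1$. A model $\mathcal V$-category is a $\mathcal V$-category $\mathcal M$ which is tensored and cotensored over $\mathcal V$ and whose underlying category is bicomplete, together with a model structure (with functorial factorizations) on the underlying category, such that the tensor $\odot:\mathcal V\times\mathcal M\to\mathcal M$ satisfies the pushout-product axiom, and such that $Q\odot m\to\mathbb 1\odot m$ is a weak equivalence for every cofibrant $m$ and every weak equivalence $Q\to\mathbb 1$ with $Q$ cofibrant. A left Quillen $\mathcal V$-functor is a $\mathcal V$-functor which is a left adjoint in a $\mathcal V$-adjunction and whose underlying functor preserves cofibrations and trivial cofibrations. Then $\mathcal U$ has a (projective) model structure whose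 weak equivalences and fibrations are the objectwise ones, and with it $\mathcal U$ is a model $\mathcal V$-category. Moreover, $y$ is universal: for every model $\mathcal V$-category $\mathcal M$ and every functor $\gamma:\mathcal C\to\mathcal M$, consider the category $\mathrm{Fact}(\gamma,y)$ whose objects are the pairs $(L,\eta)$ of a left Quillen $\mathcal V$-functor $L:\mathcal U\to\mathcal M$ and a natural transformation $\eta:Ly\to\gamma$ which is objectwise a weak equivalence, and whose morphisms $(L,\eta)\to(L',\eta')$ are the $\mathcal V$-natural transformations $\tau:L\to L'$ with $\eta'\circ\tau y=\eta$. This category is contractible, i.e. the geometric realization of its nerve is a contractible space (in particular, a factorization exists). -/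

import Mathlib

open CategoryTheory Category Limits MonoidalCategory HomotopicalAlgebra Opposite
open scoped MonoidalClosed

universe w u u' v₁ v₂ v₃ u₁ u₂ u₃

namespace EnrichedModel

/-! ### Model categories -/

section ModelCategories

/-- A bifunctor `F : A × B → D` between model categories satisfies the pushout-product axiom: for
cofibrations `f : X₁ ⟶ Y₁` and `g : X₂ ⟶ Y₂` the canonical map
`F(Y₁, X₂) ⨿_{F(X₁, X₂)} F(X₁, Y₂) ⟶ F(Y₁, Y₂)` is a cofibration, which is moreover a weak
equivalence as soon as `f` or `g` is one. -/
structure PushoutProductAxiom {A : Type u₁} {B : Type u₂} {D : Type u₃}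
    [Category.{v₁} A] [Category.{v₂} B] [Category.{v₃} D]
    [ModelCategory A] [ModelCategory B] [ModelCategory D] (F : A ⥤ B ⥤ D) : Prop where
  cofibration {X₁ Y₁ : A} (f : X₁ ⟶ Y₁) {X₂ Y₂ : B} (g : X₂ ⟶ Y₂)
    (sq : F.PushoutObjObj f g) (hf : Cofibration f) (hg : Cofibration g) : Cofibration sq.ι
  weakEquivalence {X₁ Y₁ : A} (f : X₁ ⟶ Y₁) {X₂ Y₂ : B} (g : X₂ ⟶ Y₂)
    (sq : F.PushoutObjObj f g) (hf : Cofibration f) (hg : Cofibration g)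
    (h : WeakEquivalence f ∨ WeakEquivalence g) : WeakEquivalence sq.ι

/-- The model category `M` has all small limits and colimits, and both factorizations can be
chosen functorially. -/
class IsBicompleteFunctorial (M : Type u) [Category.{w} M] [ModelCategory M] : Prop where
  hasLimits : HasLimitsOfSize.{w, w} M
  hasColimits : HasColimitsOfSize.{w, w} M
  cofibration_trivialFibration :
    MorphismProperty.HasFunctorialFactorization (cofibrations M) (trivialFibrations M)
  trivialCofibration_fibration :
    MorphismProperty.HasFunctorialFactorization (trivialCofibrations M) (fibrations M)

/-- The model structure is cofibrantly generated: there are small classes `I`, `J` of morphisms,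
both permitting the small object argument, such that the trivial fibrations are the morphisms with
the right lifting property with respect to `I`, and the fibrations are those with the right lifting
property with respect to `J`. -/
class IsCofibrantlyGenerated (M : Type u) [Category.{w} M] [ModelCategory M] : Prop where
  exists_generators : ∃ I J : MorphismProperty M,
    MorphismProperty.HasSmallObjectArgument.{w} I ∧
    MorphismProperty.HasSmallObjectArgument.{w} J ∧
    trivialFibrations M = I.rlp ∧ fibrations M = J.rlp

/-- The compatibility of a closed symmetric monoidal structure with a model structure:
the pushout-product axiom and the unit axiom. -/
class IsSymmetricMonoidalModel (V : Type u) [Category.{w} V] [MonoidalCategory V]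
    [SymmetricCategory V] [MonoidalClosed V] [ModelCategory V] : Prop where
  pushoutProduct : PushoutProductAxiom (curriedTensor V)
  unit_whiskerRight {Q : V} (q : Q ⟶ 𝟙_ V) (hQ : IsCofibrant Q) (hq : WeakEquivalence q)
    (X : V) (hX : IsCofibrant X) : WeakEquivalence (q ▷ X)
  whiskerLeft_unit {Q : V} (q : Q ⟶ 𝟙_ V) (hQ : IsCofibrant Q) (hq : WeakEquivalence q)
    (X : V) (hX : IsCofibrant X) : WeakEquivalence (X ◁ q)

end ModelCategories

/-! ### Tensors and cotensors -/

section Tensors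

variable (V : Type u) [Category.{w} V] [MonoidalCategory V] [SymmetricCategory V]
  [MonoidalClosed V]

section

variable {M : Type u'} [Category.{w} M] [EnrichedOrdinaryCategory V M]

/-- The `V`-natural transformation (in `n`) `M(t, n) ⟶ [v, M(m, n)]` which corresponds to
`η : v ⟶ M(m, t)`. -/
def tensorComparison {v : V} {m t : M} (η : v ⟶ (m ⟶[V] t)) (n : M) :
    (t ⟶[V] n) ⟶ (ihom v).obj (m ⟶[V] n) :=
  MonoidalClosed.curry (η ▷ (t ⟶[V] n) ≫ eComp V m t n)

/-- The `V`-natural transformation (in `n`) `M(n, c) ⟶ [v, M(n, m)]` which corresponds to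
`ε : v ⟶ M(c, m)`. -/
def cotensorComparison {v : V} {m c : M} (ε : v ⟶ (c ⟶[V] m)) (n : M) :
    (n ⟶[V] c) ⟶ (ihom v).obj (n ⟶[V] m) :=
  MonoidalClosed.curry ((β_ v (n ⟶[V] c)).hom ≫ (n ⟶[V] c) ◁ ε ≫ eComp V n c m)

end

variable (M : Type u') [Category.{w} M] [EnrichedOrdinaryCategory V M]

/-- A tensored `V`-category: a bifunctor `(v, m) ↦ v ⊙ m` with `V`-natural isomorphisms
`M(v ⊙ m, n) ≅ [v, M(m, n)]`, given through their universal elements `v ⟶ M(m, v ⊙ m)`. The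
bifunctor is the one induced by the universal property: this is the naturality of the universal
elements. -/
class TensoredCategory where
  tensor : V ⥤ M ⥤ M
  unit (v : V) (m : M) : v ⟶ (m ⟶[V] (tensor.obj v).obj m)
  unit_naturality_left {v v' : V} (f : v ⟶ v') (m : M) :
    f ≫ unit v' m = unit v m ≫ eHomWhiskerLeft V m ((tensor.map f).app m)
  unit_naturality_right (v : V) {m m' : M} (g : m ⟶ m') :
    unit v m ≫ eHomWhiskerLeft V m ((tensor.obj v).map g) =
      unit v m' ≫ eHomWhiskerRight V g ((tensor.obj v).obj m')
  isIso_comparison (v : V) (m n : M) : IsIso (tensorComparison V (unit v m) n)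

/-- A cotensored `V`-category: all `v` and `m` have a cotensor `c`, an object with `V`-natural
isomorphisms `M(n, c) ≅ [v, M(n, m)]`. -/
class HasCotensors : Prop where
  exists_cotensor (v : V) (m : M) : ∃ (c : M) (ε : v ⟶ (c ⟶[V] m)),
    ∀ n : M, IsIso (cotensorComparison V ε n)

/-- A model `V`-category: a `V`-category which is tensored, cotensored and whose underlying
category is bicomplete, with a model structure on the underlying category, such that the tensor
satisfies the pushout-product axiom and the unit axiom. -/
class ModelVCategory [ModelCategory V] [ModelCategory M] [TensoredCategory V M] : Prop where
  isBicompleteFunctorial : IsBicompleteFunctorial M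
  hasCotensors : HasCotensors V M
  pushoutProduct : PushoutProductAxiom (TensoredCategory.tensor (V := V) (M := M))
  unit_tensor {Q : V} (q : Q ⟶ 𝟙_ V) (hQ : IsCofibrant Q) (hq : WeakEquivalence q)
    (m : M) (hm : IsCofibrant m) :
    WeakEquivalence (((TensoredCategory.tensor (V := V) (M := M)).map q).app m)

end Tensors

/-! ### `V`-functors, `V`-natural transformations, `V`-adjunctions -/

section VFunctors

variable {V : Type u} [Category.{w} V] [MonoidalCategory V]
  {M : Type u₁} [Category.{v₁} M] [EnrichedOrdinaryCategory V M]
  {N : Type u₂} [Category.{v₂} N] [EnrichedOrdinaryCategory V N]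

/-- The functor between the underlying categories which is induced by a `V`-functor. -/
def underlying (F : EnrichedFunctor V M N) : M ⥤ N where
  obj := F.obj
  map {X Y} f := (eHomEquiv V).symm (eHomEquiv V f ≫ F.map X Y)
  map_id X := by
    apply (eHomEquiv V).injective
    simp
  map_comp {X Y Z} f g := by
    apply (eHomEquiv V).injective
    simp only [eHomEquiv_comp, Equiv.apply_symm_apply, Category.assoc, EnrichedFunctor.map_comp,
      tensorHom_comp_tensorHom_assoc]

/-- A `V`-natural transformation between `V`-functors. The naturality is an identity between
morphisms `M(X, Y) ⟶ N(F X, G Y)` in `V`; in general this is stronger than the naturality of the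
components with respect to the morphisms of the underlying category. -/
@[ext]
structure VNatTrans (F G : EnrichedFunctor V M N) where
  app (X : M) : F.obj X ⟶ G.obj X
  naturality (X Y : M) :
    F.map X Y ≫ eHomWhiskerLeft V (F.obj X) (app Y) =
      G.map X Y ≫ eHomWhiskerRight V (app X) (G.obj Y)

/-- The identity `V`-natural transformation. -/
def VNatTrans.id (F : EnrichedFunctor V M N) : VNatTrans F F where
  app X := 𝟙 (F.obj X)
  naturality X Y := by simp

/-- The composition of `V`-natural transformations. -/
def VNatTrans.comp {F G H : EnrichedFunctor V M N} (α : VNatTrans F G) (β : VNatTrans G H) :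
    VNatTrans F H where
  app X := α.app X ≫ β.app X
  naturality X Y := by
    rw [eHomWhiskerLeft_comp, eHomWhiskerRight_comp, ← Category.assoc, α.naturality,
      Category.assoc, ← eHom_whisker_exchange, ← Category.assoc, β.naturality, Category.assoc]

/-- A `V`-adjunction between `V`-functors `F : M ⟶ N` and `G : N ⟶ M`: isomorphisms
`N(F m, n) ≅ M(m, G n)` in `V` which are `V`-natural in `n` and in `m`. -/
structure VAdjunction (F : EnrichedFunctor V M N) (G : EnrichedFunctor V N M) where
  homIso (m : M) (n : N) : (F.obj m ⟶[V] n) ≅ (m ⟶[V] G.obj n)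
  naturality_right (m : M) (n n' : N) :
    eComp V (F.obj m) n n' ≫ (homIso m n').hom =
      ((homIso m n).hom ⊗ₘ G.map n n') ≫ eComp V m (G.obj n) (G.obj n')
  naturality_left (m' m : M) (n : N) :
    (F.map m' m ▷ (F.obj m ⟶[V] n)) ≫ eComp V (F.obj m') (F.obj m) n ≫ (homIso m' n).hom =
      (m' ⟶[V] m) ◁ (homIso m n).hom ≫ eComp V m' m (G.obj n)

/-- A left Quillen `V`-functor: the left adjoint in a `V`-adjunction, whose underlying functor
preserves cofibrations and trivial cofibrations. -/
structure IsLeftQuillen [ModelCategory M] [ModelCategory N] (F : EnrichedFunctor V M N) :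
    Prop where
  exists_adjunction : ∃ G : EnrichedFunctor V N M, Nonempty (VAdjunction F G)
  cofibration {X Y : M} (f : X ⟶ Y) (hf : Cofibration f) : Cofibration ((underlying F).map f)
  weakEquivalence {X Y : M} (f : X ⟶ Y) (hf : Cofibration f) (hf' : WeakEquivalence f) :
    WeakEquivalence ((underlying F).map f)

end VFunctors

/-! ### `V`-valued presheaves -/

section Presheaves

variable (V : Type u) [Category.{w} V] [MonoidalCategory V] [MonoidalClosed V]
  (C : Type w) [SmallCategory.{w} C]

/-- The `V`-category of `V`-valued presheaves on the small category `C`: the object of morphisms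
from `F` to `G` is the end of the internal homs `[F c, G c]`. -/
noncomputable instance presheafEnriched [HasLimitsOfSize.{w, w} V] :
    EnrichedOrdinaryCategory V (Cᵒᵖ ⥤ V) :=
  Enriched.FunctorCategory.enrichedOrdinaryCategory V V Cᵒᵖ

/-- The Yoneda embedding into `V`-valued presheaves: it sends `c` to the presheaf
`d ↦ ∐_{C(d, c)} 𝟙`. -/
noncomputable def vYoneda [HasColimitsOfSize.{w, w} V] : C ⥤ (Cᵒᵖ ⥤ V) :=
  yoneda ⋙ (Functor.whiskeringRight Cᵒᵖ (Type w) V).obj (sigmaConst.{w}.obj (𝟙_ V))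

/-- The given model structure on `V`-valued presheaves is the projective one: the weak equivalences
and the fibrations are defined objectwise. -/
structure IsProjective [ModelCategory V] [ModelCategory (Cᵒᵖ ⥤ V)] : Prop where
  weakEquivalence_iff {F G : Cᵒᵖ ⥤ V} (f : F ⟶ G) :
    WeakEquivalence f ↔ ∀ c : Cᵒᵖ, WeakEquivalence (f.app c)
  fibration_iff {F G : Cᵒᵖ ⥤ V} (f : F ⟶ G) :
    Fibration f ↔ ∀ c : Cᵒᵖ, Fibration (f.app c)

end Presheaves

/-! ### Factorizations through the Yoneda embedding -/

section Factorizations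

variable (V : Type u) [Category.{w} V] [MonoidalCategory V] [MonoidalClosed V]
  [HasLimitsOfSize.{w, w} V] [HasColimitsOfSize.{w, w} V]
  {C : Type w} [SmallCategory.{w} C] [ModelCategory (Cᵒᵖ ⥤ V)]
  {M : Type u'} [Category.{w} M] [EnrichedOrdinaryCategory V M] [ModelCategory M]

/-- A factorization `(L, η)` of `γ : C ⥤ M` through the Yoneda embedding `y`: a left Quillen
`V`-functor `L` from `V`-valued presheaves to `M`, and a natural transformation `η : L y ⟶ γ`
which is objectwise a weak equivalence. -/
structure Factorization (γ : C ⥤ M) where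
  L : EnrichedFunctor V (Cᵒᵖ ⥤ V) M
  isLeftQuillen : IsLeftQuillen L
  η : vYoneda V C ⋙ underlying L ⟶ γ
  weakEquivalence (c : C) : WeakEquivalence (η.app c)

variable {V}

/-- A morphism of factorizations: a `V`-natural transformation which is compatible with the
natural transformations to `γ`. -/
@[ext]
structure Factorization.Hom {γ : C ⥤ M} (P Q : Factorization V γ) where
  τ : VNatTrans P.L Q.L
  w (c : C) : τ.app ((vYoneda V C).obj c) ≫ Q.η.app c = P.η.app c

noncomputable instance Factorization.category (γ : C ⥤ M) : Category (Factorization V γ) where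
  Hom P Q := Factorization.Hom P Q
  id P := ⟨VNatTrans.id P.L, fun c => Category.id_comp (P.η.app c)⟩
  comp f g := ⟨VNatTrans.comp f.τ g.τ, fun c => by
    rw [← f.w c, ← g.w c]
    exact Category.assoc _ _ _⟩
  id_comp f := by
    apply Factorization.Hom.ext
    apply VNatTrans.ext
    funext X
    exact Category.id_comp _
  comp_id f := by
    apply Factorization.Hom.ext
    apply VNatTrans.ext
    funext X
    exact Category.comp_id _
  assoc f g h := by
    apply Factorization.Hom.ext
    apply VNatTrans.ext
    funext X
    exact Category.assoc _ _ _

end Factorizations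

/-- A category is contractible if the geometric realization of its nerve is a contractible
topological space. -/
def IsContractible (D : Type u₁) [Category.{v₁} D] : Prop :=
  ContractibleSpace (SSet.toTop.obj (nerve D))

end EnrichedModel

/-!
The idea is that a left adjoint `V`-functor on presheaves is determined by its restriction along
the Yoneda embedding `y`, so that a factorization `(L, η)` of `γ` is a choice of an objectwise
cofibrant functor `L y` with a weak equivalence to `γ`. A functorial cofibrant replacement `Q`
compares all these choices with `Q γ`.

The projective model structure (`projectiveModelCategory`) comes from the small object argument for
the generating morphisms of `V`, freely propagated along the evaluations at the objects of the
index category. The values of a relative cell complex of presheaves are relative cell complexes in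
`V` (`evaluateRelativeCellComplex`), from which smallness follows. Products in `V` show that a
projective cofibration is objectwise a cofibration (`llp_app_of_llp_functorCategory`). Tensors and
cotensors of presheaves are objectwise (`presheafTensoredCategory`), and the pushout-product axiom
follows from the one in `V` by adjunction and evaluation (`pushoutProductAxiom_presheafTensor`).

Every functor `X : C ⥤ M` has a realization, the `V`-functor `F ↦ ∫ᶜ F c ⊙ X c`, which is left
`V`-adjoint to `n ↦ M(X -, n)` (`realizationUniversalArrows`). It extends `X` along `y` and, by the
enriched Yoneda lemma, the `V`-natural transformations from the realization of `X` to any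
`V`-functor `L` are the natural transformations `X ⟶ L y` (`realizationDesc`,
`realization_vNatTrans_ext`). If `X` is objectwise cofibrant, then the realization of `X` is left
Quillen (`isLeftQuillen_realization`). For a factorization `(L, η)` of `γ`, write `R(L, η)` for the
realization of `Q L y`. The projection `Q L y ⟶ L y` and the morphism `Q η : Q L y ⟶ Q γ` induce
morphisms from `R(L, η)` to `(L, η)` and to the realization of `Q γ`. They are natural, and so they
form a zigzag between the identity functor of the category of factorizations and a constant functor
(`replacementTo`, `replacementToStandard`).

It remains to see that a natural transformation induces a homotopy between maps of realizations of
nerves (`homotopic_toTop_nerveMap`). By adjunction it is enough to define compatible maps on the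
topological prisms over simplices. A prism is a quotient of the disjoint union of its maximal
simplices (`isQuotientMap_prismProjection`). The map defined by a simplicial homotopy on these
simplices is well defined and natural, because a chain in `[n] × [1]` with positive weights is
determined, up to repetitions, by the images of the weights in `[n]` and in `[1]`: two initial
segments of a chain are comparable (`exists_predAbove_comp_eq_cut_comp_eq`,
`SimplicialHomotopy.characteristic_app_eq`).
-/

namespace EnrichedModel

/-! ### Enriched category theory -/

section EnrichedLemmas

variable {V : Type u} [Category.{w} V] [MonoidalCategory V]
  {M : Type u₁} [Category.{v₁} M] [EnrichedOrdinaryCategory V M]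
  {N : Type u₂} [Category.{v₂} N] [EnrichedOrdinaryCategory V N]

lemma eHomEquiv_eHomWhiskerLeft {X Y Z : M} (f : X ⟶ Y) (g : Y ⟶ Z) :
    eHomEquiv V f ≫ eHomWhiskerLeft V X g = eHomEquiv V (f ≫ g) := by
  rw [eHomEquiv_comp, eHomWhiskerLeft, rightUnitor_inv_naturality_assoc, tensorHom_def_assoc,
    unitors_inv_equal]

lemma eHomEquiv_eHomWhiskerRight {X Y Z : M} (f : X ⟶ Y) (g : Y ⟶ Z) :
    eHomEquiv V g ≫ eHomWhiskerRight V f Z = eHomEquiv V (f ≫ g) := by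
  rw [eHomEquiv_comp, eHomWhiskerRight, leftUnitor_inv_naturality_assoc, tensorHom_def'_assoc]

lemma eId_eHomWhiskerLeft {X Y : M} (f : X ⟶ Y) :
    eId V X ≫ eHomWhiskerLeft V X f = eHomEquiv V f := by
  rw [← eHomEquiv_id, eHomEquiv_eHomWhiskerLeft, Category.id_comp]

lemma eId_eHomWhiskerRight {X Y : M} (f : X ⟶ Y) :
    eId V Y ≫ eHomWhiskerRight V f Y = eHomEquiv V f := by
  rw [← eHomEquiv_id, eHomEquiv_eHomWhiskerRight, Category.comp_id]

lemma eHomWhiskerLeft_whiskerRight_eComp (X : M) {Y Y' : M} (g : Y ⟶ Y') (Z : M) :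
    eHomWhiskerLeft V X g ▷ (Y' ⟶[V] Z) ≫ eComp V X Y' Z =
      (X ⟶[V] Y) ◁ eHomWhiskerRight V g Z ≫ eComp V X Y Z := by
  dsimp [eHomWhiskerLeft, eHomWhiskerRight]
  simp only [MonoidalCategory.whiskerLeft_comp_assoc, whisker_assoc_symm,
    triangle_assoc_comp_left_inv_assoc, e_assoc', comp_whiskerRight, Category.assoc]

/-- The action of a `V`-functor on a morphism of the underlying category. It agrees by definition
with `(underlying F).map f`; its type mentions `F.obj` only. -/
def homMap (F : EnrichedFunctor V M N) {X Y : M} (f : X ⟶ Y) : F.obj X ⟶ F.obj Y :=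
  (underlying F).map f

lemma eHomEquiv_map (F : EnrichedFunctor V M N) {X Y : M} (f : X ⟶ Y) :
    eHomEquiv V f ≫ F.map X Y = eHomEquiv V (homMap F f) :=
  ((eHomEquiv V).apply_symm_apply _).symm

@[simp]
lemma homMap_id (F : EnrichedFunctor V M N) (X : M) : homMap F (𝟙 X) = 𝟙 (F.obj X) :=
  (underlying F).map_id X

@[simp]
lemma homMap_comp (F : EnrichedFunctor V M N) {X Y Z : M} (f : X ⟶ Y) (g : Y ⟶ Z) :
    homMap F (f ≫ g) = homMap F f ≫ homMap F g :=
  (underlying F).map_comp f g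

lemma enrichedFunctor_map_eHomWhiskerLeft (F : EnrichedFunctor V M N) (X : M) {Y Z : M}
    (g : Y ⟶ Z) :
    F.map X Y ≫ eHomWhiskerLeft V (F.obj X) (homMap F g) =
      eHomWhiskerLeft V X g ≫ F.map X Z := by
  simp only [eHomWhiskerLeft, Category.assoc, F.map_comp]
  rw [← eHomEquiv_map, rightUnitor_inv_naturality_assoc, tensorHom_def_assoc,
    MonoidalCategory.whiskerLeft_comp_assoc, whisker_exchange_assoc]

lemma enrichedFunctor_map_eHomWhiskerRight (F : EnrichedFunctor V M N) {X Y : M} (f : X ⟶ Y)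
    (Z : M) :
    F.map Y Z ≫ eHomWhiskerRight V (homMap F f) (F.obj Z) =
      eHomWhiskerRight V f Z ≫ F.map X Z := by
  simp only [eHomWhiskerRight, Category.assoc, F.map_comp]
  rw [← eHomEquiv_map, leftUnitor_inv_naturality_assoc, tensorHom_def'_assoc,
    comp_whiskerRight_assoc, ← whisker_exchange_assoc]

lemma VNatTrans.naturality_homMap {F G : EnrichedFunctor V M N} (α : VNatTrans F G)
    {X Y : M} (f : X ⟶ Y) :
    homMap F f ≫ α.app Y = α.app X ≫ homMap G f := by
  apply (eHomEquiv V).injective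
  rw [← eHomEquiv_eHomWhiskerLeft, ← eHomEquiv_eHomWhiskerRight, ← eHomEquiv_map,
    ← eHomEquiv_map, Category.assoc, Category.assoc, α.naturality]

end EnrichedLemmas

/-! ### Enriched adjunctions -/

section UniversalArrows

variable {V : Type u} [Category.{w} V] [MonoidalCategory V]
  {M : Type u₁} [Category.{v₁} M] [EnrichedOrdinaryCategory V M]
  {N : Type u₂} [Category.{v₂} N] [EnrichedOrdinaryCategory V N]

/-- The `V`-natural transformation (in `n`) `N(a, n) ⟶ M(m, S n)` which corresponds to
`η : m ⟶ S a`. -/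
def universalComparison (S : EnrichedFunctor V N M) {m : M} {a : N} (η : m ⟶ S.obj a) (n : N) :
    (a ⟶[V] n) ⟶ (m ⟶[V] S.obj n) :=
  S.map a n ≫ eHomWhiskerRight V η (S.obj n)

lemma eComp_universalComparison (S : EnrichedFunctor V N M) {m : M} {a : N} (η : m ⟶ S.obj a)
    (n n' : N) :
    eComp V a n n' ≫ universalComparison S η n' =
      (universalComparison S η n ⊗ₘ S.map n n') ≫ eComp V m (S.obj n) (S.obj n') := by
  simp only [universalComparison, S.map_comp_assoc, eComp_eHomWhiskerRight, tensorHom_def',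
    comp_whiskerRight, Category.assoc]

/-- The comparison morphisms are compatible with compositions on the left, where `l` is the action
on morphism objects of the left adjoint of `S` that is determined by the universal arrows. -/
lemma whiskerRight_eComp_universalComparison (S : EnrichedFunctor V N M) {m m' : M} {a a' : N}
    {η : m ⟶ S.obj a} {η' : m' ⟶ S.obj a'} (l : (m' ⟶[V] m) ⟶ (a' ⟶[V] a))
    (hl : l ≫ universalComparison S η' a = eHomWhiskerLeft V m' η) (n : N) :
    l ▷ (a ⟶[V] n) ≫ eComp V a' a n ≫ universalComparison S η' n =
      (m' ⟶[V] m) ◁ universalComparison S η n ≫ eComp V m' m (S.obj n) := by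
  rw [eComp_universalComparison, tensorHom_def_assoc, ← comp_whiskerRight_assoc, hl,
    ← whisker_exchange_assoc, eHomWhiskerLeft_whiskerRight_eComp, universalComparison,
    MonoidalCategory.whiskerLeft_comp_assoc]

/-- A `V`-enriched system of universal arrows from the objects of `M` to the `V`-functor `S`. -/
structure UniversalArrows (S : EnrichedFunctor V N M) where
  /-- The object which represents `n ↦ M(m, S n)`. -/
  obj (m : M) : N
  /-- The universal arrow. -/
  η (m : M) : m ⟶ S.obj (obj m)
  isIso (m : M) (n : N) : IsIso (universalComparison S (η m) n)

namespace UniversalArrows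

variable {S : EnrichedFunctor V N M} (U : UniversalArrows S)

attribute [instance] isIso

/-- The action on morphism objects of the `V`-functor which is left adjoint to `S`. -/
noncomputable def map (m m' : M) : (m ⟶[V] m') ⟶ (U.obj m ⟶[V] U.obj m') :=
  eHomWhiskerLeft V m (U.η m') ≫ inv (universalComparison S (U.η m) (U.obj m'))

@[simp]
lemma map_universalComparison (m m' : M) :
    U.map m m' ≫ universalComparison S (U.η m) (U.obj m') = eHomWhiskerLeft V m (U.η m') := by
  simp [map]

/-- The `V`-functor which is left adjoint to `S`, constructed from universal arrows. -/
noncomputable abbrev leftAdjoint : EnrichedFunctor V M N where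
  obj := U.obj
  map := U.map
  map_id _ := by
    rw [map, reassoc_of% @eId_eHomWhiskerLeft, IsIso.comp_inv_eq, universalComparison,
      S.map_id_assoc, eId_eHomWhiskerRight]
  map_comp m m' m'' := by
    rw [← cancel_mono (universalComparison S (U.η m) (U.obj m'')), Category.assoc,
      map_universalComparison, Category.assoc, tensorHom_def'_assoc,
      whiskerRight_eComp_universalComparison S _ (U.map_universalComparison m m'),
      ← MonoidalCategory.whiskerLeft_comp_assoc, map_universalComparison,
      eComp_eHomWhiskerLeft]

/-- The `V`-adjunction between `U.leftAdjoint` and `S`. -/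
noncomputable def adjunction : VAdjunction U.leftAdjoint S where
  homIso m n := asIso (universalComparison S (U.η m) n)
  naturality_right _ n n' := eComp_universalComparison S _ n n'
  naturality_left m' m n :=
    whiskerRight_eComp_universalComparison S _ (U.map_universalComparison m' m) n

lemma η_naturality {m m' : M} (f : m ⟶ m') :
    f ≫ U.η m' = U.η m ≫ homMap S (homMap U.leftAdjoint f) := by
  apply (eHomEquiv V).injective
  rw [← eHomEquiv_eHomWhiskerLeft, ← map_universalComparison, universalComparison,
    ← eHomEquiv_eHomWhiskerRight, ← eHomEquiv_map]
  have h : eHomEquiv V (homMap U.leftAdjoint f) = eHomEquiv V f ≫ U.map m m' :=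
    (eHomEquiv_map U.leftAdjoint f).symm
  rw [h, Category.assoc, Category.assoc]

/-- A morphism `f : U.obj m ⟶ n` is determined by `U.η m ≫ S f`. -/
lemma hom_ext {m : M} {n : N} {f g : U.obj m ⟶ n}
    (h : U.η m ≫ homMap S f = U.η m ≫ homMap S g) : f = g := by
  apply (eHomEquiv V).injective
  rw [← cancel_mono (universalComparison S (U.η m) n), universalComparison,
    reassoc_of% @eHomEquiv_map, reassoc_of% @eHomEquiv_map, eHomEquiv_eHomWhiskerRight,
    eHomEquiv_eHomWhiskerRight, h]

/-- The morphism `U.obj m ⟶ n` which corresponds to `f : m ⟶ S n`. -/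
noncomputable def desc {m : M} {n : N} (f : m ⟶ S.obj n) : U.obj m ⟶ n :=
  (eHomEquiv V).symm (eHomEquiv V f ≫ inv (universalComparison S (U.η m) n))

@[simp]
lemma η_desc {m : M} {n : N} (f : m ⟶ S.obj n) : U.η m ≫ homMap S (U.desc f) = f := by
  apply (eHomEquiv V).injective
  rw [← eHomEquiv_eHomWhiskerRight, ← eHomEquiv_map, desc, Equiv.apply_symm_apply,
    Category.assoc, ← universalComparison, Category.assoc, IsIso.inv_hom_id, Category.comp_id]

/-- A `V`-natural family of morphisms `f m : m ⟶ S (G m)` induces a `V`-natural transformation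
from the left adjoint of `S` to `G`. -/
noncomputable def descVNatTrans (G : EnrichedFunctor V M N) (f : ∀ m, m ⟶ S.obj (G.obj m))
    (hf : ∀ m m', eHomWhiskerLeft V m (f m') =
      G.map m m' ≫ S.map _ _ ≫ eHomWhiskerRight V (f m) (S.obj (G.obj m'))) :
    VNatTrans U.leftAdjoint G where
  app m := U.desc (f m)
  naturality m m' := by
    rw [← cancel_mono (universalComparison S (U.η m) (G.obj m'))]
    simp only [universalComparison, Category.assoc,
      ← reassoc_of% @enrichedFunctor_map_eHomWhiskerLeft,
      eHom_whisker_exchange, ← reassoc_of% @enrichedFunctor_map_eHomWhiskerRight,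
      ← eHomWhiskerRight_comp, η_desc]
    have h := eHomWhiskerLeft_comp V m (U.η m') (homMap S (U.desc (f m')))
    rw [η_desc, ← map_universalComparison, universalComparison, Category.assoc,
      Category.assoc] at h
    rw [← hf, h]

end UniversalArrows

end UniversalArrows

section Adjunctions

variable {V : Type u} [Category.{w} V] [MonoidalCategory V]
  {M : Type u₁} [Category.{v₁} M] [EnrichedOrdinaryCategory V M]
  {N : Type u₂} [Category.{v₂} N] [EnrichedOrdinaryCategory V N]

namespace VAdjunction

variable {F : EnrichedFunctor V M N} {G : EnrichedFunctor V N M} (adj : VAdjunction F G)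

/-- The bijection between morphisms of the underlying categories given by a `V`-adjunction. -/
def homEquiv (m : M) (n : N) : (F.obj m ⟶ n) ≃ (m ⟶ G.obj n) :=
  (eHomEquiv V).trans ((adj.homIso m n).homToEquiv.trans (eHomEquiv V).symm)

lemma eHomEquiv_homEquiv {m : M} {n : N} (f : F.obj m ⟶ n) :
    eHomEquiv V (adj.homEquiv m n f) = eHomEquiv V f ≫ (adj.homIso m n).hom :=
  (eHomEquiv V).apply_symm_apply _

lemma homEquiv_naturality_left {m' m : M} {n : N} (f : m' ⟶ m) (g : F.obj m ⟶ n) :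
    adj.homEquiv m' n (homMap F f ≫ g) = f ≫ adj.homEquiv m n g := by
  apply (eHomEquiv V).injective
  rw [eHomEquiv_homEquiv, eHomEquiv_comp, eHomEquiv_comp, eHomEquiv_homEquiv, ← eHomEquiv_map]
  have := adj.naturality_left m' m n
  simp only [tensorHom_def', comp_whiskerRight, Category.assoc, this,
    MonoidalCategory.whiskerLeft_comp]
  rw [← whisker_exchange_assoc]

lemma homEquiv_symm_naturality_left {m' m : M} {n : N} (f : m' ⟶ m) (g : m ⟶ G.obj n) :
    (adj.homEquiv m' n).symm (f ≫ g) = homMap F f ≫ (adj.homEquiv m n).symm g := by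
  rw [Equiv.symm_apply_eq, homEquiv_naturality_left, Equiv.apply_symm_apply]

lemma homEquiv_naturality_right {m : M} {n n' : N} (f : F.obj m ⟶ n) (g : n ⟶ n') :
    adj.homEquiv m n' (f ≫ g) = adj.homEquiv m n f ≫ homMap G g := by
  apply (eHomEquiv V).injective
  rw [eHomEquiv_homEquiv, eHomEquiv_comp, eHomEquiv_comp, eHomEquiv_homEquiv, ← eHomEquiv_map]
  simp only [Category.assoc, adj.naturality_right, tensorHom_comp_tensorHom_assoc]

/-- The adjunction between the underlying functors of `V`-functors in a `V`-adjunction. -/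
def toAdjunction : underlying F ⊣ underlying G :=
  Adjunction.mkOfHomEquiv
    { homEquiv := adj.homEquiv
      homEquiv_naturality_left_symm := adj.homEquiv_symm_naturality_left
      homEquiv_naturality_right := adj.homEquiv_naturality_right }

end VAdjunction

end Adjunctions

/-! ### The enriched category of presheaves -/

section

variable {V : Type u} [Category.{w} V] [MonoidalCategory V] [MonoidalClosed V]

lemma whiskerLeft_tensorHom_compTranspose {A B D X Y : V}
    (f : X ⟶ (ihom A).obj B) (g : Y ⟶ (ihom B).obj D) :
    A ◁ (f ⊗ₘ g) ≫ MonoidalClosed.compTranspose A B D =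
      (α_ _ _ _).inv ≫ MonoidalClosed.uncurry f ▷ Y ≫ MonoidalClosed.uncurry g := by
  rw [MonoidalClosed.compTranspose, MonoidalClosed.uncurry_eq, MonoidalClosed.uncurry_eq,
    MonoidalCategory.tensorHom_def, MonoidalCategory.whiskerLeft_comp_assoc,
    comp_whiskerRight_assoc, ← whisker_exchange_assoc]
  simp

end

section PresheafHom

variable {V : Type u} [Category.{w} V] [MonoidalCategory V] [MonoidalClosed V]
  {C : Type w} [SmallCategory.{w} C] [HasLimitsOfSize.{w, w} V]

/-- The evaluation `F c ⊗ U(F, G) ⟶ G c`, where `U(F, G)` is the object of morphisms between two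
presheaves. -/
noncomputable def presheafEv (F G : Cᵒᵖ ⥤ V) (c : Cᵒᵖ) :
    F.obj c ⊗ (F ⟶[V] G) ⟶ G.obj c :=
  MonoidalClosed.uncurry (Enriched.FunctorCategory.enrichedHomπ V F G c)

lemma presheafHom_ext {F G : Cᵒᵖ ⥤ V} {v : V} {f g : v ⟶ (F ⟶[V] G)}
    (h : ∀ c, F.obj c ◁ f ≫ presheafEv F G c = F.obj c ◁ g ≫ presheafEv F G c) : f = g := by
  refine end_.hom_ext (F := Enriched.FunctorCategory.diagram V F G) (fun c => ?_)
  apply MonoidalClosed.uncurry_injective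
  refine (MonoidalClosed.uncurry_natural_left _ _).trans (Eq.trans ?_
    (MonoidalClosed.uncurry_natural_left _ _).symm)
  exact h c

/-- The evaluations form a wedge. -/
lemma presheafEv_naturality (F G : Cᵒᵖ ⥤ V) {c d : Cᵒᵖ} (f : c ⟶ d) :
    F.map f ▷ (F ⟶[V] G) ≫ presheafEv F G d = presheafEv F G c ≫ G.map f := by
  have h := Enriched.FunctorCategory.enrichedHom_condition V F G f
  rw [MonoidalClosed.enrichedOrdinaryCategorySelf_eHomWhiskerLeft,
    MonoidalClosed.enrichedOrdinaryCategorySelf_eHomWhiskerRight] at h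
  have h' := congrArg MonoidalClosed.uncurry h
  refine Eq.trans ?_ (h'.symm.trans ?_)
  · exact (MonoidalClosed.uncurry_pre_app _ _ _).symm
  · exact MonoidalClosed.uncurry_natural_right _ _

/-- The morphism to `U(F, G)` which corresponds to a natural family of morphisms
`F c ⊗ v ⟶ G c`. -/
noncomputable def presheafHomLift {F G : Cᵒᵖ ⥤ V} {v : V} (θ : ∀ c, F.obj c ⊗ v ⟶ G.obj c)
    (hθ : ∀ ⦃c d : Cᵒᵖ⦄ (f : c ⟶ d), F.map f ▷ v ≫ θ d = θ c ≫ G.map f) : v ⟶ (F ⟶[V] G) :=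
  end_.lift (F := Enriched.FunctorCategory.diagram V F G)
    (fun c => MonoidalClosed.curry (θ c)) (fun c d f => by
      dsimp only [Enriched.FunctorCategory.diagram]
      change _ ≫ eHomWhiskerLeft V (F.obj c) (G.map f) = _ ≫ eHomWhiskerRight V (F.map f) (G.obj d)
      rw [MonoidalClosed.enrichedOrdinaryCategorySelf_eHomWhiskerLeft,
        MonoidalClosed.enrichedOrdinaryCategorySelf_eHomWhiskerRight]
      apply MonoidalClosed.uncurry_injective
      refine (MonoidalClosed.uncurry_natural_right _ _).trans (Eq.trans ?_
        (MonoidalClosed.uncurry_pre_app _ _ _).symm)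
      rw [MonoidalClosed.uncurry_curry, MonoidalClosed.uncurry_curry, hθ])

@[simp]
lemma presheafHomLift_ev {F G : Cᵒᵖ ⥤ V} {v : V} (θ : ∀ c, F.obj c ⊗ v ⟶ G.obj c)
    (hθ : ∀ ⦃c d : Cᵒᵖ⦄ (f : c ⟶ d), F.map f ▷ v ≫ θ d = θ c ≫ G.map f) (c : Cᵒᵖ) :
    F.obj c ◁ presheafHomLift θ hθ ≫ presheafEv F G c = θ c := by
  refine (MonoidalClosed.uncurry_natural_left _ _).symm.trans ?_
  refine Eq.trans (congrArg _ (end_.lift_π _ _ _)) (MonoidalClosed.uncurry_curry _)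

@[simp]
lemma whiskerLeft_eHomEquiv_presheafEv {F G : Cᵒᵖ ⥤ V} (τ : F ⟶ G) (c : Cᵒᵖ) :
    F.obj c ◁ eHomEquiv V τ ≫ presheafEv F G c = (ρ_ _).hom ≫ τ.app c := by
  refine (MonoidalClosed.uncurry_natural_left _ _).symm.trans ?_
  refine Eq.trans (congrArg _ (Enriched.FunctorCategory.homEquiv_apply_π V τ c)) ?_
  exact MonoidalClosed.uncurry_curry _

lemma whiskerLeft_eComp_presheafEv (F G H : Cᵒᵖ ⥤ V) (c : Cᵒᵖ) :
    F.obj c ◁ eComp V F G H ≫ presheafEv F H c =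
      (α_ _ _ _).inv ≫ presheafEv F G c ▷ (G ⟶[V] H) ≫ presheafEv G H c := by
  refine (MonoidalClosed.uncurry_natural_left _ _).symm.trans ?_
  refine Eq.trans (congrArg _ (Enriched.FunctorCategory.enrichedComp_π V F G H c)) ?_
  refine (MonoidalClosed.uncurry_natural_left _ _).trans ?_
  refine Eq.trans (congrArg _ (MonoidalClosed.uncurry_curry _)) ?_
  dsimp only [MonoidalClosed.compTranspose]
  refine (whiskerLeft_tensorHom_compTranspose
    (Enriched.FunctorCategory.enrichedHomπ V F G c)
    (Enriched.FunctorCategory.enrichedHomπ V G H c)).trans rfl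

@[simp]
lemma whiskerLeft_eId_presheafEv (F : Cᵒᵖ ⥤ V) (c : Cᵒᵖ) :
    F.obj c ◁ eId V F ≫ presheafEv F F c = (ρ_ _).hom := by
  rw [← eHomEquiv_id, whiskerLeft_eHomEquiv_presheafEv, NatTrans.id_app, Category.comp_id]

@[simp]
lemma whiskerLeft_eHomWhiskerLeft_presheafEv (F : Cᵒᵖ ⥤ V) {G H : Cᵒᵖ ⥤ V} (g : G ⟶ H)
    (c : Cᵒᵖ) :
    F.obj c ◁ eHomWhiskerLeft V F g ≫ presheafEv F H c = presheafEv F G c ≫ g.app c := by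
  simp only [eHomWhiskerLeft, MonoidalCategory.whiskerLeft_comp, Category.assoc,
    whiskerLeft_eComp_presheafEv, associator_inv_naturality_right_assoc,
    whisker_exchange_assoc, whiskerLeft_eHomEquiv_presheafEv]
  simp

@[simp]
lemma whiskerLeft_eHomWhiskerRight_presheafEv {F G : Cᵒᵖ ⥤ V} (f : F ⟶ G) (H : Cᵒᵖ ⥤ V)
    (c : Cᵒᵖ) :
    F.obj c ◁ eHomWhiskerRight V f H ≫ presheafEv F H c =
      f.app c ▷ (G ⟶[V] H) ≫ presheafEv G H c := by
  simp only [eHomWhiskerRight, MonoidalCategory.whiskerLeft_comp, Category.assoc,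
    whiskerLeft_eComp_presheafEv, associator_inv_naturality_middle_assoc,
    ← comp_whiskerRight_assoc, whiskerLeft_eHomEquiv_presheafEv]
  simp

end PresheafHom

/-! ### Tensors and cotensors in enriched categories -/

section Comparisons

variable {V : Type u} [Category.{w} V] [MonoidalCategory V] [MonoidalClosed V]
  {M : Type u'} [Category.{w} M] [EnrichedOrdinaryCategory V M]

/-- The evaluation `A ⊗ [A, B] ⟶ B`. It agrees by definition with `(ihom.ev A).app B`, whose source
is the value at `B` of a composition of functors. -/
def ihomEv (A B : V) : A ⊗ (ihom A).obj B ⟶ B := (ihom.ev A).app B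

@[simp]
lemma ihomEv_naturality (A : V) {B B' : V} (f : B ⟶ B') :
    A ◁ (ihom A).map f ≫ ihomEv A B' = ihomEv A B ≫ f :=
  ihom.ev_naturality A f

@[simp]
lemma whiskerLeft_curry_ihomEv {A B X : V} (g : A ⊗ X ⟶ B) :
    A ◁ MonoidalClosed.curry g ≫ ihomEv A B = g :=
  MonoidalClosed.whiskerLeft_curry_ihom_ev_app _ _ g

lemma uncurry_comp_tensorComparison {v z : V} {m t : M} (η : v ⟶ (m ⟶[V] t)) {n : M}
    (f : z ⟶ (t ⟶[V] n)) :
    MonoidalClosed.uncurry (f ≫ tensorComparison V η n) =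
      v ◁ f ≫ η ▷ (t ⟶[V] n) ≫ eComp V m t n := by
  rw [MonoidalClosed.uncurry_natural_left, tensorComparison, MonoidalClosed.uncurry_curry]

lemma tensorComparison_comp_eHomWhiskerLeft {v : V} {m t t' : M} (η : v ⟶ (m ⟶[V] t))
    (f : t ⟶ t') (n : M) :
    tensorComparison V (η ≫ eHomWhiskerLeft V m f) n =
      eHomWhiskerRight V f n ≫ tensorComparison V η n := by
  apply MonoidalClosed.uncurry_injective
  rw [uncurry_comp_tensorComparison, tensorComparison, MonoidalClosed.uncurry_curry,
    comp_whiskerRight_assoc, eHomWhiskerLeft_whiskerRight_eComp, whisker_exchange_assoc]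

lemma tensorComparison_comp_left {v v' : V} {m t : M} (f : v' ⟶ v) (η : v ⟶ (m ⟶[V] t)) (n : M) :
    tensorComparison V (f ≫ η) n =
      tensorComparison V η n ≫ (MonoidalClosed.pre f).app (m ⟶[V] n) := by
  rw [tensorComparison, tensorComparison, MonoidalClosed.curry_pre_app, comp_whiskerRight_assoc]

lemma tensorComparison_comp_eHomWhiskerRight {v : V} {m m' t : M} (η : v ⟶ (m ⟶[V] t))
    (g : m' ⟶ m) (n : M) :
    tensorComparison V (η ≫ eHomWhiskerRight V g t) n =
      tensorComparison V η n ≫ (ihom v).map (eHomWhiskerRight V g n) := by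
  rw [tensorComparison, tensorComparison, ← MonoidalClosed.curry_natural_right, Category.assoc,
    eComp_eHomWhiskerRight, comp_whiskerRight_assoc]

/-- If `t` is a tensor of `v` and `m`, then the morphisms `t ⟶ n` correspond to the morphisms
`v ⟶ M(m, n)` in `V`. -/
lemma bijective_of_isIso_tensorComparison {v : V} {m t : M} (η : v ⟶ (m ⟶[V] t)) (n : M)
    [IsIso (tensorComparison V η n)] :
    Function.Bijective (fun f : t ⟶ n => η ≫ eHomWhiskerLeft V m f) := by
  have h : (fun f : t ⟶ n => η ≫ eHomWhiskerLeft V m f) =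
      (fun f => (MonoidalClosed.curryHomEquiv').symm
        (eHomEquiv V f ≫ tensorComparison V η n)) := by
    funext f
    apply (MonoidalClosed.curryHomEquiv' (X := v) (Y := (m ⟶[V] n))).injective
    rw [Equiv.apply_symm_apply]
    apply MonoidalClosed.uncurry_injective
    rw [uncurry_comp_tensorComparison]
    refine (MonoidalClosed.uncurry_curry _).trans ?_
    rw [eHomWhiskerLeft]
    simp only [whisker_exchange_assoc, Category.assoc, MonoidalCategory.whiskerRight_id]
  rw [h]
  exact (Equiv.bijective _).comp
    (((isIso_iff_yoneda_map_bijective (tensorComparison V η n)).1 inferInstance _).comp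
      (Equiv.bijective _))

variable [SymmetricCategory V]

/-- If `c` is a cotensor of `m` by `v`, then the morphisms `n ⟶ c` correspond to the morphisms
`v ⟶ M(n, m)` in `V`. -/
lemma bijective_of_isIso_cotensorComparison {v : V} {m c : M} (ε : v ⟶ (c ⟶[V] m)) (n : M)
    [IsIso (cotensorComparison V ε n)] :
    Function.Bijective (fun f : n ⟶ c => ε ≫ eHomWhiskerRight V f m) := by
  have h : (fun f : n ⟶ c => ε ≫ eHomWhiskerRight V f m) =
      (fun f => (MonoidalClosed.curryHomEquiv').symm
        (eHomEquiv V f ≫ cotensorComparison V ε n)) := by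
    funext f
    apply (MonoidalClosed.curryHomEquiv' (X := v) (Y := (n ⟶[V] m))).injective
    rw [Equiv.apply_symm_apply]
    apply MonoidalClosed.uncurry_injective
    rw [MonoidalClosed.uncurry_natural_left, cotensorComparison, MonoidalClosed.uncurry_curry]
    refine (MonoidalClosed.uncurry_curry _).trans ?_
    rw [eHomWhiskerRight]
    simp only [BraidedCategory.braiding_naturality_right_assoc, braiding_tensorUnit_right,
      ← whisker_exchange_assoc, Category.assoc, id_whiskerLeft, Iso.inv_hom_id_assoc]
  rw [h]
  exact (Equiv.bijective _).comp
    (((isIso_iff_yoneda_map_bijective (cotensorComparison V ε n)).1 inferInstance _).comp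
      (Equiv.bijective _))

end Comparisons

/-! ### Tensors and cotensors of presheaves -/

section PresheafTensors

variable (V : Type u) [Category.{w} V] [MonoidalCategory V] [SymmetricCategory V]
  [MonoidalClosed V] (C : Type w) [SmallCategory.{w} C]

/-- The objectwise tensor product of an object of `V` and a presheaf. -/
abbrev presheafTensor : V ⥤ (Cᵒᵖ ⥤ V) ⥤ (Cᵒᵖ ⥤ V) :=
  curriedTensor V ⋙ Functor.whiskeringRight Cᵒᵖ V V

/-- The objectwise internal hom from an object of `V` to a presheaf. -/
abbrev presheafCotensor : Vᵒᵖ ⥤ (Cᵒᵖ ⥤ V) ⥤ (Cᵒᵖ ⥤ V) :=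
  MonoidalClosed.internalHom ⋙ Functor.whiskeringRight Cᵒᵖ V V

variable [HasLimitsOfSize.{w, w} V]
variable {V C}

/-- The universal element `v ⟶ U(F, v ⊗ F)`. -/
noncomputable def presheafTensorUnit (v : V) (F : Cᵒᵖ ⥤ V) :
    v ⟶ (F ⟶[V] ((presheafTensor V C).obj v).obj F) :=
  presheafHomLift (fun c => (β_ (F.obj c) v).hom) (fun c d f => by simp)

@[simp]
lemma presheafTensorUnit_ev (v : V) (F : Cᵒᵖ ⥤ V) (c : Cᵒᵖ) :
    F.obj c ◁ presheafTensorUnit v F ≫ presheafEv F _ c = (β_ (F.obj c) v).hom :=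
  presheafHomLift_ev _ _ c

/-- The universal element `v ⟶ U([v, F], F)`. -/
noncomputable def presheafCotensorCounit (v : V) (F : Cᵒᵖ ⥤ V) :
    v ⟶ ((F ⋙ ihom v) ⟶[V] F) :=
  presheafHomLift (F := F ⋙ ihom v)
    (fun c => (β_ ((ihom v).obj (F.obj c)) v).hom ≫ ihomEv v (F.obj c))
    (fun c d f => by
      change (ihom v).map (F.map f) ▷ v ≫ _ = _
      rw [BraidedCategory.braiding_naturality_left_assoc, ihomEv_naturality, Category.assoc])

lemma presheafCotensorCounit_ev (v : V) (F : Cᵒᵖ ⥤ V) (c : Cᵒᵖ) :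
    ((ihom v).obj (F.obj c)) ◁ presheafCotensorCounit v F ≫ presheafEv (F ⋙ ihom v) F c =
      (β_ _ v).hom ≫ ihomEv v (F.obj c) :=
  presheafHomLift_ev (F := F ⋙ ihom v) _ _ c

/-- The comparison morphism of the tensor `v ⊗ F`, evaluated at `c`, is given by the evaluation at
`c` of morphisms of presheaves, up to the symmetry. -/
lemma presheaf_tensorComparison_ev (v : V) (F G : Cᵒᵖ ⥤ V) {z : V}
    (f : z ⟶ (((presheafTensor V C).obj v).obj F ⟶[V] G)) (c : Cᵒᵖ) :
    F.obj c ◁ MonoidalClosed.uncurry (f ≫ tensorComparison V (presheafTensorUnit v F) G) ≫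
      presheafEv F G c =
    (α_ _ _ _).inv ≫ (β_ (F.obj c) v).hom ▷ z ≫ (v ⊗ F.obj c) ◁ f ≫
      presheafEv (((presheafTensor V C).obj v).obj F) G c := by
  rw [uncurry_comp_tensorComparison]
  simp only [MonoidalCategory.whiskerLeft_comp, Category.assoc, whiskerLeft_eComp_presheafEv,
    associator_inv_naturality_middle_assoc, associator_inv_naturality_right_assoc]
  rw [← comp_whiskerRight_assoc, presheafTensorUnit_ev, whisker_exchange_assoc]
  rfl

/-- The comparison morphism of the cotensor `[v, F]`, evaluated at `c`, is given by the evaluation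
at `c` of morphisms of presheaves, up to the symmetry and to the evaluation `v ⊗ [v, F c] ⟶ F c`. -/
lemma presheaf_cotensorComparison_ev (v : V) (F G : Cᵒᵖ ⥤ V) {z : V}
    (f : z ⟶ (G ⟶[V] (F ⋙ ihom v))) (c : Cᵒᵖ) :
    G.obj c ◁ MonoidalClosed.uncurry (f ≫ cotensorComparison V (presheafCotensorCounit v F) G) ≫
      presheafEv G F c =
    (α_ _ _ _).inv ≫ (β_ (G.obj c) v).hom ▷ z ≫ (α_ _ _ _).hom ≫ v ◁ (G.obj c ◁ f ≫
      presheafEv G (F ⋙ ihom v) c) ≫ ihomEv v (F.obj c) := by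
  have h₁ : MonoidalClosed.uncurry (f ≫ cotensorComparison V (presheafCotensorCounit v F) G) =
      (β_ v z).hom ≫ f ▷ v ≫ (G ⟶[V] (F ⋙ ihom v)) ◁ presheafCotensorCounit v F ≫
        eComp V G (F ⋙ ihom v) F := by
    rw [MonoidalClosed.uncurry_natural_left, cotensorComparison, MonoidalClosed.uncurry_curry,
      BraidedCategory.braiding_naturality_right_assoc]
  have h₂ : G.obj c ◁ (β_ v z).hom ≫ (α_ _ _ _).inv ≫ (β_ (G.obj c ⊗ z) v).hom =
      (α_ _ _ _).inv ≫ (β_ (G.obj c) v).hom ▷ z ≫ (α_ _ _ _).hom := by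
    rw [BraidedCategory.braiding_tensor_left_hom]
    simp only [Iso.inv_hom_id_assoc, ← MonoidalCategory.whiskerLeft_comp_assoc,
      SymmetricCategory.symmetry, MonoidalCategory.whiskerLeft_id, Category.id_comp]
  have h₃ := presheafCotensorCounit_ev v F c
  have h₄ : G.obj c ◁ ((G ⟶[V] (F ⋙ ihom v)) ◁ presheafCotensorCounit v F ≫
        eComp V G (F ⋙ ihom v) F) ≫ presheafEv G F c =
      (α_ _ _ _).inv ≫ presheafEv G (F ⋙ ihom v) c ▷ v ≫ (β_ _ _).hom ≫
        ihomEv v (F.obj c) := by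
    rw [MonoidalCategory.whiskerLeft_comp, Category.assoc, whiskerLeft_eComp_presheafEv,
      associator_inv_naturality_right_assoc, whisker_exchange_assoc]
    refine congrArg _ (congrArg _ ?_)
    exact h₃
  rw [h₁, ← Category.assoc, MonoidalCategory.whiskerLeft_comp, Category.assoc, h₄,
    MonoidalCategory.whiskerLeft_comp, Category.assoc, associator_inv_naturality_middle_assoc,
    ← comp_whiskerRight_assoc]
  have h₅ := BraidedCategory.braiding_naturality_left
    (G.obj c ◁ f ≫ presheafEv G (F ⋙ ihom v) c) v
  refine Eq.trans (congrArg _ (congrArg _ ((Category.assoc _ _ _).symm.trans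
    ((congrArg (· ≫ _) h₅).trans (Category.assoc _ _ _))))) ?_
  rw [reassoc_of% h₂]

/-- The tensors of presheaves are defined objectwise. -/
noncomputable abbrev presheafTensoredCategory : TensoredCategory V (Cᵒᵖ ⥤ V) where
  tensor := presheafTensor V C
  unit := presheafTensorUnit
  unit_naturality_left f F := by
    apply presheafHom_ext
    intro c
    rw [MonoidalCategory.whiskerLeft_comp, Category.assoc, presheafTensorUnit_ev,
      MonoidalCategory.whiskerLeft_comp, Category.assoc, whiskerLeft_eHomWhiskerLeft_presheafEv,
      ← Category.assoc, presheafTensorUnit_ev]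
    exact BraidedCategory.braiding_naturality_right _ _
  unit_naturality_right v F G g := by
    apply presheafHom_ext
    intro c
    rw [MonoidalCategory.whiskerLeft_comp, Category.assoc, whiskerLeft_eHomWhiskerLeft_presheafEv,
      ← Category.assoc, presheafTensorUnit_ev, MonoidalCategory.whiskerLeft_comp, Category.assoc,
      whiskerLeft_eHomWhiskerRight_presheafEv, whisker_exchange_assoc, presheafTensorUnit_ev]
    exact (BraidedCategory.braiding_naturality_left _ _).symm
  isIso_comparison v F G := by
    rw [isIso_iff_yoneda_map_bijective]
    intro z
    constructor
    · intro f g hfg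
      apply presheafHom_ext
      intro c
      have h := presheaf_tensorComparison_ev v F G f c
      dsimp at hfg
      rw [hfg, presheaf_tensorComparison_ev] at h
      rw [cancel_epi, cancel_epi] at h
      exact h.symm
    · intro g
      refine ⟨presheafHomLift (fun c => (β_ (F.obj c) v).inv ▷ z ≫ (α_ _ _ _).hom ≫
        F.obj c ◁ MonoidalClosed.uncurry g ≫ presheafEv F G c) ?_, ?_⟩
      · intro c d f
        have h₁ : (v ◁ F.map f) ▷ z ≫ (β_ (F.obj d) v).inv ▷ z =
            (β_ (F.obj c) v).inv ▷ z ≫ F.map f ▷ v ▷ z := by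
          rw [← comp_whiskerRight, BraidedCategory.braiding_inv_naturality_right,
            comp_whiskerRight]
        simp only [Category.assoc, ← presheafEv_naturality]
        refine (Category.assoc _ _ _).symm.trans ((congrArg (fun x => x ≫ _) h₁).trans ?_)
        simp [whisker_exchange_assoc]
      · apply MonoidalClosed.uncurry_injective
        apply presheafHom_ext
        intro c
        dsimp only
        rw [presheaf_tensorComparison_ev]
        refine Eq.trans (congrArg _ (congrArg _ (presheafHomLift_ev
          (F := ((presheafTensor V C).obj v).obj F) _ _ c))) ?_
        simp [← comp_whiskerRight_assoc]

/-- The cotensors of presheaves are defined objectwise. -/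
instance : HasCotensors V (Cᵒᵖ ⥤ V) where
  exists_cotensor v F := ⟨F ⋙ ihom v, presheafCotensorCounit v F, fun G => by
    rw [isIso_iff_yoneda_map_bijective]
    intro z
    constructor
    · intro f g hfg
      apply presheafHom_ext
      intro c
      have h := presheaf_cotensorComparison_ev v F G f c
      dsimp at hfg
      rw [hfg, presheaf_cotensorComparison_ev] at h
      rw [cancel_epi, cancel_epi, cancel_epi] at h
      exact (MonoidalClosed.uncurry_injective h).symm
    · intro g
      refine ⟨presheafHomLift (G := F ⋙ ihom v) (fun c => MonoidalClosed.curry ((α_ _ _ _).inv ≫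
        (β_ (G.obj c) v).inv ▷ z ≫ (α_ _ _ _).hom ≫
        G.obj c ◁ MonoidalClosed.uncurry g ≫ presheafEv G F c)) ?_, ?_⟩
      · intro c d f
        apply MonoidalClosed.uncurry_injective
        refine (MonoidalClosed.uncurry_natural_left _ _).trans (Eq.trans ?_
          (MonoidalClosed.uncurry_natural_right _ _).symm)
        rw [MonoidalClosed.uncurry_curry, MonoidalClosed.uncurry_curry]
        simp only [Category.assoc, ← presheafEv_naturality]
        have h₁ : v ◁ G.map f ▷ z ≫ (α_ _ _ _).inv ≫ (β_ (G.obj d) v).inv ▷ z =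
            (α_ _ _ _).inv ≫ (β_ (G.obj c) v).inv ▷ z ≫ G.map f ▷ v ▷ z := by
          rw [associator_inv_naturality_middle_assoc, ← comp_whiskerRight,
            BraidedCategory.braiding_inv_naturality_right, comp_whiskerRight]
        rw [reassoc_of% h₁]
        simp [whisker_exchange_assoc]
      · apply MonoidalClosed.uncurry_injective
        apply presheafHom_ext
        intro c
        dsimp only
        rw [presheaf_cotensorComparison_ev, presheafHomLift_ev (G := F ⋙ ihom v)]
        rw [whiskerLeft_curry_ihomEv]
        simp [← comp_whiskerRight_assoc]⟩

end PresheafTensors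

/-! ### The realization of presheaves along a functor -/

section Singular

variable {V : Type u} [Category.{w} V] [MonoidalCategory V] [MonoidalClosed V]
  [HasLimitsOfSize.{w, w} V] {C : Type w} [SmallCategory.{w} C]
  {M : Type u'} [Category.{w} M] [EnrichedOrdinaryCategory V M]

variable (V) in
/-- The presheaf `c ↦ M(X c, n)`. -/
abbrev singularObj (X : C ⥤ M) (n : M) : Cᵒᵖ ⥤ V where
  obj c := X.obj c.unop ⟶[V] n
  map f := eHomWhiskerRight V (X.map f.unop) n
  map_id c := by simp
  map_comp f g := by simp [eHomWhiskerRight_comp]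

variable (V) in
/-- The `V`-functor which sends `n` to the presheaf `c ↦ M(X c, n)`. -/
noncomputable abbrev singular (X : C ⥤ M) : EnrichedFunctor V M (Cᵒᵖ ⥤ V) where
  obj n := singularObj V X n
  map n n' := presheafHomLift (F := singularObj V X n) (G := singularObj V X n')
    (fun c => eComp V (X.obj c.unop) n n') (fun c d f => by
      exact (eComp_eHomWhiskerRight V (X.map f.unop) n n').symm)
  map_id n := by
    apply presheafHom_ext
    intro c
    rw [MonoidalCategory.whiskerLeft_comp, Category.assoc, presheafHomLift_ev,
      whiskerLeft_eId_presheafEv, ← cancel_epi (ρ_ _).inv, e_comp_id, Iso.inv_hom_id]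
  map_comp n n' n'' := by
    apply presheafHom_ext
    intro c
    rw [MonoidalCategory.whiskerLeft_comp, Category.assoc, presheafHomLift_ev,
      MonoidalCategory.whiskerLeft_comp, Category.assoc, whiskerLeft_eComp_presheafEv,
      MonoidalCategory.tensorHom_def, MonoidalCategory.whiskerLeft_comp, Category.assoc,
      associator_inv_naturality_right_assoc, whisker_exchange_assoc,
      associator_inv_naturality_middle_assoc, presheafHomLift_ev, ← comp_whiskerRight_assoc,
      presheafHomLift_ev]
    simp

variable (X : C ⥤ M)

@[simp]
lemma singular_map_ev (n n' : M) (c : Cᵒᵖ) :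
    (X.obj c.unop ⟶[V] n) ◁ (singular V X).map n n' ≫
      presheafEv (singularObj V X n) (singularObj V X n') c = eComp V (X.obj c.unop) n n' :=
  presheafHomLift_ev (F := singularObj V X n) (G := singularObj V X n')
    (fun c => eComp V (X.obj c.unop) n n')
    (fun _ _ f => (eComp_eHomWhiskerRight V (X.map f.unop) n n').symm) c

lemma homMap_singular_app {n n' : M} (g : n ⟶ n') (c : Cᵒᵖ) :
    (homMap (singular V X) g).app c = eHomWhiskerLeft V (X.obj c.unop) g := by
  rw [← cancel_epi (ρ_ _).hom]
  refine (whiskerLeft_eHomEquiv_presheafEv (homMap (singular V X) g) c).symm.trans ?_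
  rw [← eHomEquiv_map, MonoidalCategory.whiskerLeft_comp, Category.assoc]
  refine (congrArg _ (singular_map_ev X n n' c)).trans ?_
  rw [eHomWhiskerLeft, Iso.hom_inv_id_assoc]

/-- For the `V`-functor `n ↦ M(X -, n)`, the universal comparison morphism is objectwise the
comparison morphism of a tensor. -/
lemma uncurry_comp_universalComparison_singular {F : Cᵒᵖ ⥤ V} {a : M}
    (η : F ⟶ singularObj V X a) (n : M) {z : V} (f : z ⟶ (a ⟶[V] n)) (c : Cᵒᵖ) :
    F.obj c ◁ (f ≫ universalComparison (singular V X) η n) ≫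
        presheafEv F (singularObj V X n) c =
      MonoidalClosed.uncurry (f ≫ tensorComparison V (m := X.obj c.unop) (η.app c) n) := by
  rw [uncurry_comp_tensorComparison, universalComparison,
    MonoidalCategory.whiskerLeft_comp, Category.assoc, MonoidalCategory.whiskerLeft_comp,
    Category.assoc, whiskerLeft_eHomWhiskerRight_presheafEv, whisker_exchange_assoc]
  refine congrArg _ (congrArg _ ?_)
  exact singular_map_ev X a n c

end Singular

section Realization

variable {V : Type u} [Category.{w} V] [MonoidalCategory V] [SymmetricCategory V]
  [MonoidalClosed V] [HasLimitsOfSize.{w, w} V] {C : Type w} [SmallCategory.{w} C]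
  {M : Type u'} [Category.{w} M] [EnrichedOrdinaryCategory V M] [TensoredCategory V M]
  [HasColimitsOfSize.{w, w} M] (X : C ⥤ M)

/-- The bifunctor `(c, d) ↦ F c ⊙ X d`. -/
abbrev realizationDiagram (F : Cᵒᵖ ⥤ V) : Cᵒᵖ ⥤ C ⥤ M :=
  F ⋙ TensoredCategory.tensor ⋙ (Functor.whiskeringLeft C M M).obj X

/-- The universal morphism `F c ⟶ M(X c, ∫ᵈ F d ⊙ X d)`. -/
noncomputable def realizationUnitApp (F : Cᵒᵖ ⥤ V) (c : Cᵒᵖ) :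
    F.obj c ⟶ (X.obj c.unop ⟶[V] coend (realizationDiagram X F)) :=
  TensoredCategory.unit (F.obj c) (X.obj c.unop) ≫
    eHomWhiskerLeft V (X.obj c.unop) (coend.ι (realizationDiagram X F) c.unop)

/-- The universal morphism from `F` to the presheaf `c ↦ M(X c, ∫ᵈ F d ⊙ X d)`. -/
noncomputable def realizationUnit (F : Cᵒᵖ ⥤ V) :
    F ⟶ singularObj V X (coend (realizationDiagram X F)) where
  app c := realizationUnitApp X F c
  naturality c d f := by
    dsimp only [realizationUnitApp]
    rw [Category.assoc, eHom_whisker_exchange]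
    have h₁ := coend.condition (realizationDiagram X F) f.unop
    have h₂ := TensoredCategory.unit_naturality_left (F.map f) (X.obj d.unop)
    have h₃ := TensoredCategory.unit_naturality_right (F.obj c) (X.map f.unop)
    rw [reassoc_of% h₂, ← reassoc_of% h₃, ← eHomWhiskerLeft_comp, ← eHomWhiskerLeft_comp]
    exact congrArg (fun k => _ ≫ eHomWhiskerLeft V (X.obj d.unop) k) h₁

attribute [instance] TensoredCategory.isIso_comparison

/-- The coend `∫ᶜ F c ⊙ X c` represents `n ↦ U(F, M(X -, n))` in the enriched sense: as `M` has
cotensors, the universal property of the coend for morphisms of the underlying category extends to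
generalized elements of the morphism objects. -/
lemma isIso_universalComparison_realizationUnit [HasCotensors V M] (F : Cᵒᵖ ⥤ V) (n : M) :
    IsIso (universalComparison (singular V X) (realizationUnit X F) n) := by
  rw [isIso_iff_yoneda_map_bijective]
  intro z
  -- generalized elements `z ⟶ M(t, n)` are morphisms to the cotensor `e` of `n` by `z`.
  obtain ⟨e, ε, hε⟩ := HasCotensors.exists_cotensor (V := V) z n
  have hbij (t : M) := bijective_of_isIso_cotensorComparison ε t
  have hcomp (f : z ⟶ (coend (realizationDiagram X F) ⟶[V] n)) (c : Cᵒᵖ) :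
      F.obj c ◁ (f ≫ universalComparison (singular V X) (realizationUnit X F) n) ≫
        presheafEv F (singularObj V X n) c =
      MonoidalClosed.uncurry ((f ≫ eHomWhiskerRight V
        (coend.ι (realizationDiagram X F) c.unop) n) ≫
          tensorComparison V (TensoredCategory.unit (F.obj c) (X.obj c.unop)) n) := by
    rw [uncurry_comp_universalComparison_singular]
    refine congrArg _ ?_
    rw [Category.assoc, ← tensorComparison_comp_eHomWhiskerLeft]
    rfl
  constructor
  · intro f g hfg
    dsimp only at hfg
    obtain ⟨f', rfl⟩ := (hbij _).2 f
    obtain ⟨g', rfl⟩ := (hbij _).2 g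
    refine congrArg (fun f => ε ≫ eHomWhiskerRight V f n)
      (coend.hom_ext (fun c => (hbij _).1 ?_))
    dsimp only
    have h := hcomp (ε ≫ eHomWhiskerRight V f' n) (op c)
    rw [hfg, hcomp] at h
    have h' := (cancel_mono _).1 (MonoidalClosed.uncurry_injective h)
    rw [eHomWhiskerRight_comp, eHomWhiskerRight_comp, ← Category.assoc, ← Category.assoc]
    exact h'.symm
  · intro g
    -- `k c : F c ⊙ X c ⟶ n` is the component of the morphism from the coend corresponding to `g`
    have hk (c : C) := (hbij _).2 (MonoidalClosed.curry
      (F.obj (op c) ◁ g ≫ presheafEv F (singularObj V X n) (op c)) ≫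
        inv (tensorComparison V (TensoredCategory.unit (F.obj (op c)) (X.obj c)) n))
    choose k hk using hk
    dsimp only at hk
    have hk' (c : C) : (ε ≫ eHomWhiskerRight V (k c) n) ≫
        tensorComparison V (TensoredCategory.unit (F.obj (op c)) (X.obj c)) n =
        MonoidalClosed.curry (F.obj (op c) ◁ g ≫ presheafEv F (singularObj V X n) (op c)) := by
      rw [hk, Category.assoc, IsIso.inv_hom_id, Category.comp_id]
    have hw : ∀ ⦃i j : C⦄ (f : i ⟶ j),
        ((realizationDiagram X F).map f.op).app i ≫ k i =
          ((realizationDiagram X F).obj (op j)).map f ≫ k j := by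
      intro i j f
      apply (hbij _).1
      dsimp only
      rw [← cancel_mono (tensorComparison V
        (TensoredCategory.unit (F.obj (op j)) (X.obj i)) n)]
      have h₁ : eHomWhiskerRight V (((realizationDiagram X F).map f.op).app i) n ≫
          tensorComparison V (TensoredCategory.unit (F.obj (op j)) (X.obj i)) n =
          tensorComparison V (TensoredCategory.unit (F.obj (op i)) (X.obj i)) n ≫
            (MonoidalClosed.pre (F.map f.op)).app (X.obj i ⟶[V] n) := by
        rw [← tensorComparison_comp_left, TensoredCategory.unit_naturality_left,
          tensorComparison_comp_eHomWhiskerLeft]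
        rfl
      have h₂ : eHomWhiskerRight V (((realizationDiagram X F).obj (op j)).map f) n ≫
          tensorComparison V (TensoredCategory.unit (F.obj (op j)) (X.obj i)) n =
          tensorComparison V (TensoredCategory.unit (F.obj (op j)) (X.obj j)) n ≫
            (ihom (F.obj (op j))).map (eHomWhiskerRight V (X.map f) n) := by
        rw [← tensorComparison_comp_eHomWhiskerRight, ← TensoredCategory.unit_naturality_right,
          tensorComparison_comp_eHomWhiskerLeft]
        rfl
      rw [eHomWhiskerRight_comp, eHomWhiskerRight_comp, Category.assoc, Category.assoc,
        Category.assoc, Category.assoc]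
      refine (congrArg _ (congrArg _ h₁)).trans (Eq.trans ?_ (congrArg _ (congrArg _ h₂)).symm)
      have h₃ := hk' i
      have h₄ := hk' j
      simp only [Category.assoc] at h₃ h₄
      rw [reassoc_of% h₃, reassoc_of% h₄]
      rw [MonoidalClosed.curry_pre_app, ← MonoidalClosed.curry_natural_right]
      refine congrArg _ ?_
      rw [Category.assoc, ← whisker_exchange_assoc, presheafEv_naturality]
      rfl
    refine ⟨ε ≫ eHomWhiskerRight V (coend.desc k hw) n, ?_⟩
    apply presheafHom_ext
    intro c
    dsimp only
    rw [hcomp, Category.assoc ε, ← eHomWhiskerRight_comp, coend.ι_desc]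
    refine (congrArg _ (hk' c.unop)).trans ?_
    exact MonoidalClosed.uncurry_curry _

/-- The universal arrows `F ⟶ M(X -, ∫ᶜ F c ⊙ X c)`. -/
noncomputable def realizationUniversalArrows [HasCotensors V M] :
    UniversalArrows (singular V X) where
  obj F := coend (realizationDiagram X F)
  η F := realizationUnit X F
  isIso F n := isIso_universalComparison_realizationUnit X F n

end Realization

/-! ### The enriched Yoneda lemma -/

section Yoneda

variable {V : Type u} [Category.{w} V] [MonoidalCategory V]
  {C : Type w} [SmallCategory.{w} C] [HasColimitsOfSize.{w, w} V]

/-- The inclusion `𝟙 ⟶ y(c)(d)` of the summand indexed by `g : d ⟶ c`. -/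
noncomputable def yonedaι {d c : C} (g : d ⟶ c) : 𝟙_ V ⟶ ((vYoneda V C).obj c).obj (op d) :=
  Sigma.ι (fun _ : d ⟶ c => 𝟙_ V) g

@[simp]
lemma yonedaι_map {e d c : C} (g : d ⟶ c) (f : e ⟶ d) :
    yonedaι (V := V) g ≫ ((vYoneda V C).obj c).map f.op = yonedaι (f ≫ g) := by
  simp [yonedaι, vYoneda, sigmaConst]

@[simp]
lemma yonedaι_app {d c c' : C} (g : d ⟶ c) (h : c ⟶ c') :
    yonedaι (V := V) g ≫ ((vYoneda V C).map h).app (op d) = yonedaι (g ≫ h) := by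
  simp [yonedaι, vYoneda, sigmaConst]

/-- The morphism from the coproduct `y(c)(d)` with given components. -/
noncomputable def yonedaDesc {d c : C} {v : V} (k : (d ⟶ c) → (𝟙_ V ⟶ v)) :
    ((vYoneda V C).obj c).obj (op d) ⟶ v :=
  Sigma.desc k

@[simp]
lemma yonedaι_yonedaDesc {d c : C} {v : V} (k : (d ⟶ c) → (𝟙_ V ⟶ v)) (g : d ⟶ c) :
    yonedaι g ≫ yonedaDesc k = k g :=
  Sigma.ι_desc _ _

variable [MonoidalClosed V]

section

variable [SymmetricCategory V]

/-- As the tensor product preserves colimits, a morphism from `y(c)(d) ⊗ z` is determined by its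
components. -/
lemma yoneda_tensor_hom_ext {d c : C} {z v : V}
    {f g : ((vYoneda V C).obj c).obj (op d) ⊗ z ⟶ v}
    (h : ∀ k : d ⟶ c, yonedaι k ▷ z ≫ f = yonedaι k ▷ z ≫ g) : f = g := by
  rw [← cancel_epi (β_ z _).hom]
  apply MonoidalClosed.curry_injective
  refine Sigma.hom_ext _ _ (fun k => ?_)
  change yonedaι k ≫ _ = yonedaι k ≫ _
  rw [← MonoidalClosed.curry_natural_left, ← MonoidalClosed.curry_natural_left,
    BraidedCategory.braiding_naturality_right_assoc,
    BraidedCategory.braiding_naturality_right_assoc, h]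

/-- The morphism `y(c)(d) ⊗ F c ⟶ F d` given by the action of `C(d, c)` on `F`. -/
noncomputable def yonedaAction (F : Cᵒᵖ ⥤ V) (c d : C) :
    ((vYoneda V C).obj c).obj (op d) ⊗ F.obj (op c) ⟶ F.obj (op d) :=
  (β_ _ _).hom ≫ MonoidalClosed.uncurry (yonedaDesc (fun g : d ⟶ c =>
    MonoidalClosed.curry ((ρ_ (F.obj (op c))).hom ≫ F.map g.op)))

@[simp]
lemma yonedaι_yonedaAction (F : Cᵒᵖ ⥤ V) {c d : C} (g : d ⟶ c) :
    yonedaι g ▷ F.obj (op c) ≫ yonedaAction F c d = (λ_ _).hom ≫ F.map g.op := by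
  rw [yonedaAction, BraidedCategory.braiding_naturality_left_assoc,
    ← MonoidalClosed.uncurry_natural_left]
  rw [yonedaι_yonedaDesc, MonoidalClosed.uncurry_curry, braiding_rightUnitor_assoc]

end

variable [HasLimitsOfSize.{w, w} V]

/-- The evaluation at the identity `U(y c, F) ⟶ F c`. -/
noncomputable def yonedaEv (c : C) (F : Cᵒᵖ ⥤ V) :
    ((vYoneda V C).obj c ⟶[V] F) ⟶ F.obj (op c) :=
  (λ_ _).inv ≫ yonedaι (𝟙 c) ▷ _ ≫ presheafEv ((vYoneda V C).obj c) F (op c)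

lemma eComp_yonedaEv (c : C) (F G : Cᵒᵖ ⥤ V) :
    eComp V ((vYoneda V C).obj c) F G ≫ yonedaEv c G =
      yonedaEv c F ▷ (F ⟶[V] G) ≫ presheafEv F G (op c) := by
  rw [yonedaEv, leftUnitor_inv_naturality_assoc, whisker_exchange_assoc,
    whiskerLeft_eComp_presheafEv, associator_inv_naturality_left_assoc, yonedaEv]
  simp

@[simp]
lemma eHomWhiskerLeft_yonedaEv (c : C) {F G : Cᵒᵖ ⥤ V} (τ : F ⟶ G) :
    eHomWhiskerLeft V ((vYoneda V C).obj c) τ ≫ yonedaEv c G =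
      yonedaEv c F ≫ τ.app (op c) := by
  rw [yonedaEv, leftUnitor_inv_naturality_assoc, whisker_exchange_assoc,
    whiskerLeft_eHomWhiskerLeft_presheafEv, yonedaEv, Category.assoc, Category.assoc]

lemma eHomWhiskerRight_yonedaEv {c c' : C} (h : c ⟶ c') (F : Cᵒᵖ ⥤ V) :
    eHomWhiskerRight V ((vYoneda V C).map h) F ≫ yonedaEv c F =
      yonedaEv c' F ≫ F.map h.op := by
  have h₁ := yonedaι_app (V := V) (𝟙 c) h
  have h₂ := yonedaι_map (V := V) (𝟙 c') h
  have h₃ := presheafEv_naturality ((vYoneda V C).obj c') F h.op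
  rw [yonedaEv, leftUnitor_inv_naturality_assoc, whisker_exchange_assoc,
    whiskerLeft_eHomWhiskerRight_presheafEv, yonedaEv, Category.assoc, Category.assoc, ← h₃,
    ← comp_whiskerRight_assoc, ← comp_whiskerRight_assoc, h₁, h₂, Category.id_comp,
    Category.comp_id]

@[simp]
lemma eId_yonedaEv (c : C) :
    eId V ((vYoneda V C).obj c) ≫ yonedaEv c ((vYoneda V C).obj c) = yonedaι (𝟙 c) := by
  rw [yonedaEv, leftUnitor_inv_naturality_assoc, whisker_exchange_assoc,
    whiskerLeft_eId_presheafEv]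
  simp [unitors_inv_equal]

variable [SymmetricCategory V]

/-- The enriched Yoneda lemma. -/
instance (c : C) (F : Cᵒᵖ ⥤ V) : IsIso (yonedaEv c F) := by
  refine ⟨presheafHomLift (F := (vYoneda V C).obj c) (v := F.obj (op c))
    (fun d => yonedaAction F c d.unop) (fun d e f => yoneda_tensor_hom_ext (fun k => ?_)),
    ?_, ?_⟩
  · have h := yonedaι_map (V := V) k f.unop
    have h' := yonedaι_yonedaAction F k
    refine (Category.assoc _ _ _).symm.trans (((congrArg (fun x => x ≫ _)
      ((comp_whiskerRight _ _ _).symm.trans (congrArg (fun x => x ▷ _) h))).trans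
        (yonedaι_yonedaAction F (f.unop ≫ k))).trans ?_)
    refine Eq.trans ?_ ((congrArg (fun x => x ≫ F.map f) h').symm.trans (Category.assoc _ _ _))
    simp
  · apply presheafHom_ext
    rintro ⟨d⟩
    rw [MonoidalCategory.whiskerLeft_comp, Category.assoc, presheafHomLift_ev,
      MonoidalCategory.whiskerLeft_id, Category.id_comp]
    apply yoneda_tensor_hom_ext
    intro g
    have h := presheafEv_naturality ((vYoneda V C).obj c) F g.op
    have h' := yonedaι_map (V := V) (𝟙 c) g
    rw [← whisker_exchange_assoc, yonedaι_yonedaAction, id_whiskerLeft_assoc, Iso.inv_hom_id_assoc,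
      yonedaEv]
    simp only [Category.assoc, Iso.hom_inv_id_assoc]
    rw [← h, ← comp_whiskerRight_assoc, h', Category.comp_id]
  · have h := presheafHomLift_ev (F := (vYoneda V C).obj c) (G := F) (v := F.obj (op c))
      (fun d => yonedaAction F c d.unop)
    rw [yonedaEv, leftUnitor_inv_naturality_assoc, whisker_exchange_assoc, h,
      yonedaι_yonedaAction]
    simp

end Yoneda

/-! ### `V`-natural transformations out of realizations -/

section Extensions

variable {V : Type u} [Category.{w} V] [MonoidalCategory V] [SymmetricCategory V]
  [MonoidalClosed V] [HasLimitsOfSize.{w, w} V] [HasColimitsOfSize.{w, w} V]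
  {C : Type w} [SmallCategory.{w} C]
  {M : Type u'} [Category.{w} M] [EnrichedOrdinaryCategory V M]

section

variable {X : C ⥤ M} (L : EnrichedFunctor V (Cᵒᵖ ⥤ V) M)
  (θ : ∀ c, X.obj c ⟶ L.obj ((vYoneda V C).obj c))

/-- The morphism `F c ≅ U(y c, F) ⟶ M(L (y c), L F) ⟶ M(X c, L F)`. -/
noncomputable def extensionApp (F : Cᵒᵖ ⥤ V) (c : C) :
    F.obj (op c) ⟶ (X.obj c ⟶[V] L.obj F) :=
  inv (yonedaEv c F) ≫ L.map ((vYoneda V C).obj c) F ≫ eHomWhiskerRight V (θ c) (L.obj F)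

@[simp]
lemma yonedaEv_extensionApp (F : Cᵒᵖ ⥤ V) (c : C) :
    yonedaEv c F ≫ extensionApp L θ F c =
      L.map ((vYoneda V C).obj c) F ≫ eHomWhiskerRight V (θ c) (L.obj F) := by
  simp [extensionApp]

variable (hθ : ∀ ⦃c d : C⦄ (h : c ⟶ d), X.map h ≫ θ d = θ c ≫ homMap L ((vYoneda V C).map h))

/-- The morphism of presheaves `F ⟶ M(X -, L F)` which corresponds to a natural transformation
from `X` to the restriction of `L` along the Yoneda embedding. -/
noncomputable def extensionHom (F : Cᵒᵖ ⥤ V) : F ⟶ singularObj V X (L.obj F) where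
  app c := extensionApp L θ F c.unop
  naturality c d f := by
    rw [← cancel_epi (yonedaEv c.unop F)]
    have h := eHomWhiskerRight_yonedaEv (V := V) f.unop F
    have h' := enrichedFunctor_map_eHomWhiskerRight L ((vYoneda V C).map f.unop) F
    refine (Category.assoc _ _ _).symm.trans ((congrArg (fun x => x ≫ _) h).symm.trans ?_)
    refine Eq.trans ?_ (Category.assoc _ _ _)
    refine Eq.trans ?_ (congrArg (fun x => x ≫ _) (yonedaEv_extensionApp L θ F c.unop)).symm
    rw [Category.assoc, yonedaEv_extensionApp, Category.assoc, ← reassoc_of% h']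
    refine congrArg _ ?_
    rw [← eHomWhiskerRight_comp, ← hθ, eHomWhiskerRight_comp]

/-- The morphisms `F ⟶ M(X -, L F)` are `V`-natural in `F`. -/
lemma extensionHom_naturality (F G : Cᵒᵖ ⥤ V) :
    eHomWhiskerLeft V F (extensionHom L θ hθ G) =
      L.map F G ≫ (singular V X).map _ _ ≫
        eHomWhiskerRight V (extensionHom L θ hθ F) (singularObj V X (L.obj G)) := by
  apply presheafHom_ext
  rintro ⟨c⟩
  rw [← cancel_epi (yonedaEv c F ▷ _), whiskerLeft_eHomWhiskerLeft_presheafEv,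
    ← reassoc_of% @eComp_yonedaEv]
  have h₁ := singular_map_ev (V := V) X (L.obj F) (L.obj G) (op c)
  have h₂ : (extensionHom L θ hθ F).app (op c) = extensionApp L θ F c := rfl
  have h₃ : (extensionHom L θ hθ G).app (op c) = extensionApp L θ G c := rfl
  rw [MonoidalCategory.whiskerLeft_comp, Category.assoc, MonoidalCategory.whiskerLeft_comp,
    Category.assoc, whiskerLeft_eHomWhiskerRight_presheafEv, whisker_exchange_assoc,
    whisker_exchange_assoc, h₂, h₃, yonedaEv_extensionApp,
    ← comp_whiskerRight_assoc, yonedaEv_extensionApp]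
  refine Eq.trans ?_ (congrArg _ (congrArg _ h₁)).symm
  rw [L.map_comp_assoc, MonoidalCategory.tensorHom_def_assoc, eComp_eHomWhiskerRight,
    comp_whiskerRight_assoc, whisker_exchange_assoc]

end

variable [TensoredCategory V M] [HasColimitsOfSize.{w, w} M] [HasCotensors V M]

variable (V) in
/-- The left adjoint `V`-functor `F ↦ ∫ᶜ F c ⊙ X c`. -/
noncomputable abbrev realization (X : C ⥤ M) : EnrichedFunctor V (Cᵒᵖ ⥤ V) M :=
  (realizationUniversalArrows X).leftAdjoint

variable (X : C ⥤ M)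

variable (V) in
/-- The morphism from `X c` to the realization of the representable presheaf `y c`. -/
noncomputable def toRealizationYoneda (c : C) :
    X.obj c ⟶ (realization V X).obj ((vYoneda V C).obj c) :=
  (eHomEquiv V).symm
    (yonedaι (𝟙 c) ≫ ((realizationUniversalArrows X).η ((vYoneda V C).obj c)).app (op c))

lemma eHomEquiv_toRealizationYoneda (c : C) :
    eHomEquiv V (toRealizationYoneda V X c) =
      yonedaι (𝟙 c) ≫ ((realizationUniversalArrows X).η ((vYoneda V C).obj c)).app (op c) :=
  Equiv.apply_symm_apply _ _

/-- Under the enriched Yoneda lemma, the universal arrow at `y c` corresponds to the morphism from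
`X c` to the realization of `y c`. -/
lemma universalComparison_yonedaEv (c : C) (n : M) :
    universalComparison (singular V X)
        ((realizationUniversalArrows X).η ((vYoneda V C).obj c)) n ≫
          yonedaEv c (singularObj V X n) =
      eHomWhiskerRight V (toRealizationYoneda V X c) n := by
  have h := uncurry_comp_universalComparison_singular X
    ((realizationUniversalArrows X).η ((vYoneda V C).obj c)) n (𝟙 _) (op c)
  rw [uncurry_comp_tensorComparison] at h
  simp only [Category.id_comp, MonoidalCategory.whiskerLeft_id] at h
  rw [yonedaEv, leftUnitor_inv_naturality_assoc, whisker_exchange_assoc, h, eHomWhiskerRight,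
    eHomEquiv_toRealizationYoneda, comp_whiskerRight_assoc]

/-- The realization of `X` extends `X` along the Yoneda embedding. -/
instance (c : C) : IsIso (toRealizationYoneda V X c) := by
  have h (n : M) : Function.Bijective (fun f : (realization V X).obj ((vYoneda V C).obj c) ⟶ n =>
      toRealizationYoneda V X c ≫ f) := by
    have h₁ : (fun f : (realization V X).obj ((vYoneda V C).obj c) ⟶ n =>
        toRealizationYoneda V X c ≫ f) = fun f => (eHomEquiv V).symm
          (eHomEquiv V f ≫ eHomWhiskerRight V (toRealizationYoneda V X c) n) := by
      funext f
      rw [eHomEquiv_eHomWhiskerRight, Equiv.symm_apply_apply]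
    have h₂ : IsIso (eHomWhiskerRight V (toRealizationYoneda V X c) n) := by
      rw [← universalComparison_yonedaEv]
      infer_instance
    rw [h₁]
    exact (Equiv.bijective _).comp
      (((isIso_iff_yoneda_map_bijective _).1 h₂ _).comp (Equiv.bijective _))
  exact (isIso_iff_coyoneda_map_bijective _).2 h

/-- The unit of the realization is the extension of its restriction to the representable
presheaves. -/
lemma realizationUnit_app (F : Cᵒᵖ ⥤ V) (c : C) :
    ((realizationUniversalArrows X).η F).app (op c) =
      extensionApp (realization V X) (toRealizationYoneda V X) F c := by
  rw [← cancel_epi (yonedaEv c F), yonedaEv_extensionApp, ← universalComparison_yonedaEv]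
  have h := (realizationUniversalArrows X).map_universalComparison ((vYoneda V C).obj c) F
  refine Eq.trans ?_ ((congrArg (fun x => x ≫ _) h).symm.trans (Category.assoc _ _ _))
  exact (eHomWhiskerLeft_yonedaEv _ _).symm

lemma toRealizationYoneda_naturality {c d : C} (h : c ⟶ d) :
    X.map h ≫ toRealizationYoneda V X d =
      toRealizationYoneda V X c ≫ homMap (realization V X) ((vYoneda V C).map h) := by
  apply (eHomEquiv V).injective
  have h₁ := congrArg (fun f => NatTrans.app f (op c))
    ((realizationUniversalArrows X).η_naturality ((vYoneda V C).map h))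
  have h₂ := homMap_singular_app (V := V) X
    (homMap (realization V X) ((vYoneda V C).map h)) (op c)
  have h₃ := ((realizationUniversalArrows X).η ((vYoneda V C).obj d)).naturality h.op
  have h₄ := yonedaι_app (V := V) (𝟙 c) h
  have h₅ := yonedaι_map (V := V) (𝟙 d) h
  rw [← eHomEquiv_eHomWhiskerRight, ← eHomEquiv_eHomWhiskerLeft, eHomEquiv_toRealizationYoneda,
    eHomEquiv_toRealizationYoneda, Category.assoc, Category.assoc]
  refine (congrArg _ h₃).symm.trans (Eq.trans ?_
    (congrArg _ (h₁.trans (congrArg _ h₂))))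
  refine Eq.trans ?_ (Category.assoc _ _ _)
  rw [h₄]
  refine (Category.assoc _ _ _).symm.trans ?_
  rw [h₅]
  simp

variable {X} {L : EnrichedFunctor V (Cᵒᵖ ⥤ V) M}

lemma realizationUnit_app_eHomWhiskerLeft (τ : VNatTrans (realization V X) L) (F : Cᵒᵖ ⥤ V)
    (c : C) :
    ((realizationUniversalArrows X).η F).app (op c) ≫
        eHomWhiskerLeft V (X.obj c) (τ.app F) =
      extensionApp L (fun c => toRealizationYoneda V X c ≫ τ.app _) F c := by
  rw [realizationUnit_app, ← cancel_epi (yonedaEv c F)]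
  refine (Category.assoc _ _ _).symm.trans ((congrArg (fun x => x ≫ _)
    (yonedaEv_extensionApp _ _ _ _)).trans ?_)
  rw [yonedaEv_extensionApp, Category.assoc, ← eHom_whisker_exchange,
    eHomWhiskerRight_comp, ← Category.assoc, ← Category.assoc]
  exact congrArg (fun x => x ≫ _) (τ.naturality ((vYoneda V C).obj c) F)

/-- A `V`-natural transformation from a realization is determined by its restriction to the
representable presheaves. -/
lemma realization_vNatTrans_ext {τ τ' : VNatTrans (realization V X) L}
    (h : ∀ c, toRealizationYoneda V X c ≫ τ.app ((vYoneda V C).obj c) =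
      toRealizationYoneda V X c ≫ τ'.app ((vYoneda V C).obj c)) : τ = τ' := by
  apply VNatTrans.ext
  funext F
  apply (realizationUniversalArrows X).hom_ext
  apply NatTrans.ext
  funext ⟨c⟩
  have h₁ := realizationUnit_app_eHomWhiskerLeft τ F c
  have h₂ := realizationUnit_app_eHomWhiskerLeft τ' F c
  rw [show (fun c => toRealizationYoneda V X c ≫ τ.app ((vYoneda V C).obj c)) = _ from
    funext h, ← h₂] at h₁
  refine (congrArg _ (homMap_singular_app X (τ.app F) (op c))).trans (Eq.trans h₁
    (congrArg _ (homMap_singular_app X (τ'.app F) (op c))).symm)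

variable (θ : ∀ c, X.obj c ⟶ L.obj ((vYoneda V C).obj c))
  (hθ : ∀ ⦃c d : C⦄ (h : c ⟶ d), X.map h ≫ θ d = θ c ≫ homMap L ((vYoneda V C).map h))

/-- The `V`-natural transformation from the realization of `X` to `L` induced by a natural
transformation from `X` to the restriction of `L` along the Yoneda embedding. -/
noncomputable def realizationDesc : VNatTrans (realization V X) L :=
  (realizationUniversalArrows X).descVNatTrans L (extensionHom L θ hθ)
    (extensionHom_naturality L θ hθ)

@[simp]
lemma toRealizationYoneda_realizationDesc (c : C) :
    toRealizationYoneda V X c ≫ (realizationDesc θ hθ).app ((vYoneda V C).obj c) = θ c := by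
  apply (eHomEquiv V).injective
  have h₁ := congrArg (fun f => NatTrans.app f (op c))
    ((realizationUniversalArrows X).η_desc (extensionHom L θ hθ ((vYoneda V C).obj c)))
  have h₂ := homMap_singular_app (V := V) X
    ((realizationUniversalArrows X).desc (extensionHom L θ hθ ((vYoneda V C).obj c))) (op c)
  have h₃ := yonedaEv_extensionApp L θ ((vYoneda V C).obj c) c
  rw [← eHomEquiv_eHomWhiskerLeft, eHomEquiv_toRealizationYoneda, Category.assoc]
  refine (congrArg _ ((congrArg _ h₂).symm.trans h₁)).trans ?_
  have h₄ : (extensionHom L θ hθ ((vYoneda V C).obj c)).app (op c) =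
    extensionApp L θ ((vYoneda V C).obj c) c := rfl
  rw [h₄, ← eId_yonedaEv, Category.assoc]
  refine (congrArg _ h₃).trans ?_
  rw [L.map_id_assoc, eId_eHomWhiskerRight]

end Extensions

/-! ### The small object argument for categories of functors -/

section SmallObject

open MorphismProperty SmallObject

variable {J : Type w} [SmallCategory.{w} J] {V : Type u} [Category.{w} V]
  [HasColimitsOfSize.{w, w} V]

section

variable {T : Type u₁} {A B : T → V} (g : ∀ t, A t ⟶ B t)

/-- The morphisms of functors which are freely generated, at an object of `J`, by a morphism
in a given family. -/
noncomputable abbrev freeFamily (x : J × T) :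
    (evaluationLeftAdjoint V x.1).obj (A x.2) ⟶ (evaluationLeftAdjoint V x.1).obj (B x.2) :=
  (evaluationLeftAdjoint V x.1).map (g x.2)

/-- If `F : J ⥤ V` is obtained by attaching cells of the form `freeFamily g`, then its value at
`d : J` is obtained by attaching cells of the form `g`: the value at `d` of a free functor
is a coproduct of copies of its generating object. -/
noncomputable def evaluateAttachCells {F G : J ⥤ V} {f : F ⟶ G}
    (c : AttachCells.{w} (freeFamily (J := J) g) f) (d : J) : AttachCells.{w} g (f.app d) where
  ι := Σ k : c.ι, ((c.π k).1 ⟶ d)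
  π s := (c.π s.1).2
  cofan₁ := Cofan.mk (c.cofan₁.pt.obj d) (fun s =>
    Sigma.ι (fun _ : (c.π s.1).1 ⟶ d => A (c.π s.1).2) s.2 ≫ (c.cofan₁.inj s.1).app d)
  cofan₂ := Cofan.mk (c.cofan₂.pt.obj d) (fun s =>
    Sigma.ι (fun _ : (c.π s.1).1 ⟶ d => B (c.π s.1).2) s.2 ≫ (c.cofan₂.inj s.1).app d)
  isColimit₁ := Cofan.isColimitTrans _
    (isColimitCofanMkObjOfIsColimit ((evaluation J V).obj d) _ (fun k => c.cofan₁.inj k)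
      c.isColimit₁) _ (fun k => coproductIsCoproduct (fun _ : (c.π k).1 ⟶ d => A (c.π k).2))
  isColimit₂ := Cofan.isColimitTrans _
    (isColimitCofanMkObjOfIsColimit ((evaluation J V).obj d) _ (fun k => c.cofan₂.inj k)
      c.isColimit₂) _ (fun k => coproductIsCoproduct (fun _ : (c.π k).1 ⟶ d => B (c.π k).2))
  m := c.m.app d
  hm s := by
    have h := congrArg (fun f => NatTrans.app f d) (c.hm s.1)
    have h' : Sigma.ι (fun _ : (c.π s.1).1 ⟶ d => A (c.π s.1).2) s.2 ≫
        (freeFamily (J := J) g (c.π s.1)).app d =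
        g (c.π s.1).2 ≫ Sigma.ι (fun _ : (c.π s.1).1 ⟶ d => B (c.π s.1).2) s.2 :=
      Sigma.ι_desc _ _
    exact (Category.assoc _ _ _).trans ((congrArg _ h).trans ((Category.assoc _ _ _).symm.trans
      ((congrArg (fun x => x ≫ _) h').trans (Category.assoc _ _ _))))
  g₁ := c.g₁.app d
  g₂ := c.g₂.app d
  isPushout := c.isPushout.map ((evaluation J V).obj d)

/-- The values of a relative cell complex of functors are relative cell complexes. -/
noncomputable def evaluateRelativeCellComplex {K : Type w} [LinearOrder K] [OrderBot K]
    [SuccOrder K] [WellFoundedLT K] {F G : J ⥤ V} {f : F ⟶ G}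
    (c : RelativeCellComplex.{w} (fun _ : K => freeFamily (J := J) g) f) (d : J) :
    RelativeCellComplex.{w} (fun _ : K => g) (f.app d) where
  toTransfiniteCompositionOfShape :=
    c.toTransfiniteCompositionOfShape.map ((evaluation J V).obj d)
  attachCells j hj := evaluateAttachCells g (c.attachCells j hj) d

end

/-- A relative cell complex only depends on the class of morphisms given by a family of cells. -/
noncomputable def relativeCellComplexOfLE {D : Type u₂} [Category.{v₂} D] {T : Type u₁}
    {A B : T → D} (g : ∀ t, A t ⟶ B t) {T' : Type u₃} {A' B' : T' → D} (g' : ∀ t, A' t ⟶ B' t)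
    (h : ofHoms g ≤ ofHoms g') {K : Type w} [LinearOrder K] [OrderBot K]
    [SuccOrder K] [WellFoundedLT K] {X Y : D} {f : X ⟶ Y}
    (c : RelativeCellComplex.{w} (fun _ : K => g) f) :
    RelativeCellComplex.{w} (fun _ : K => g') f where
  toTransfiniteCompositionOfShape := c.toTransfiniteCompositionOfShape
  attachCells j hj := Nonempty.some ((nonempty_attachCells_iff _ _).2
    (pushouts_monotone (coproducts_monotone h) _ (c.attachCells j hj).pushouts_coproducts))

variable (J) in
/-- The class of morphisms of functors which are freely generated, at an object of `J`, by a
morphism in `I`. -/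
noncomputable def freeMorphisms (I : MorphismProperty V) : MorphismProperty (J ⥤ V) :=
  ofHoms (freeFamily (J := J) I.homFamily)

/-- The domains of the generating morphisms of functors are small, because morphisms out of a free
functor are computed by an evaluation, and evaluations send relative cell complexes to relative cell
complexes. -/
instance (I : MorphismProperty V) [HasSmallObjectArgument.{w} I] :
    HasSmallObjectArgument.{w} (freeMorphisms J I) where
  exists_cardinal := by
    obtain ⟨κ, _, _, _⟩ := HasSmallObjectArgument.exists_cardinal.{w} (I := I)
    exact ⟨κ, inferInstance, inferInstance,
      { isSmall := by
          have : IsSmall.{w} I := isSmall I κ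
          have : Small.{w} I.toSet := IsSmall.small_toSet
          exact isSmall_ofHoms _
        preservesColimit := by
          intro A B F G i hi f hf
          rw [freeMorphisms, ofHoms_iff] at hi
          obtain ⟨⟨d, ⟨t, ht⟩⟩, hi⟩ := hi
          obtain rfl : A = (evaluationLeftAdjoint V d).obj t.left := congrArg Comma.left hi
          have e : coyoneda.obj (op ((evaluationLeftAdjoint V d).obj t.left)) ≅
              (evaluation J V).obj d ⋙ coyoneda.obj (op t.left) :=
            (evaluationAdjunctionRight V d).compCoyonedaIso.app (op t.left)
          have : PreservesColimit (hf.F ⋙ (evaluation J V).obj d) (coyoneda.obj (op t.left)) :=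
            preservesColimit I κ t.hom ht _ (evaluateRelativeCellComplex I.homFamily
              (relativeCellComplexOfLE (freeMorphisms J I).homFamily _
                (by rw [ofHoms_homFamily]; rfl) hf) d)
          exact preservesColimit_of_natIso _ e.symm }⟩

lemma freeMorphisms_rlp (I : MorphismProperty V) {F G : J ⥤ V} (p : F ⟶ G) :
    (freeMorphisms J I).rlp p ↔ ∀ d, I.rlp (p.app d) := by
  constructor
  · intro h d A B i hi
    have := h ((evaluationLeftAdjoint V d).map i)
      ((ofHoms_iff _ _).2 ⟨⟨d, ⟨Arrow.mk i, hi⟩⟩, rfl⟩)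
    exact ((evaluationAdjunctionRight V d).hasLiftingProperty_iff i p).1 this
  · intro h A B i hi
    obtain ⟨⟨d, ⟨t, ht⟩⟩, hi⟩ := (ofHoms_iff _ _).1 hi
    have h' : HasLiftingProperty ((evaluationLeftAdjoint V d).map t.hom) p :=
      ((evaluationAdjunctionRight V d).hasLiftingProperty_iff t.hom p).2 (h d t.hom ht)
    have := HasLiftingProperty.iff_of_arrow_iso_left (eqToIso hi) p
    exact this.2 h'

end SmallObject

/-! ### The projective model structure -/

section Projective

open MorphismProperty

variable {J : Type w} [SmallCategory.{w} J] {V : Type u} [Category.{w} V]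

/-- The right adjoint of the evaluation at `d` is given by products, so that it preserves the
classes of morphisms which are stable under products. Hence the evaluation at `d` preserves
left lifting properties. -/
lemma llp_app_of_llp_functorCategory [HasLimitsOfSize.{w, w} V] {W : MorphismProperty V}
    [∀ T : Type w, W.IsStableUnderProductsOfShape T] {F G : J ⥤ V} {i : F ⟶ G}
    (hi : (W.functorCategory J).llp i) (d : J) : W.llp (i.app d) := by
  intro A B p hp
  have h : W.functorCategory J ((evaluationRightAdjoint V d).map p) := by
    intro t
    let α : Discrete.functor (fun _ : t ⟶ d => A) ⟶ Discrete.functor (fun _ : t ⟶ d => B) :=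
      Discrete.natTrans (fun _ => p)
    have h₁ : ((evaluationRightAdjoint V d).map p).app t = limMap α := by
      refine Pi.hom_ext _ _ (fun g => ?_)
      exact (limit.lift_π _ _).trans (limMap_π α ⟨g⟩).symm
    rw [h₁]
    exact MorphismProperty.limMap _ (fun _ => hp)
  exact ((evaluationAdjunctionLeft V d).hasLiftingProperty_iff i p).2 (hi _ h)

variable [ModelCategory V] [HasColimitsOfSize.{w, w} V] [IsCofibrantlyGenerated V]

lemma exists_rlp_eq_functorCategory_trivialFibrations :
    ∃ I : MorphismProperty (J ⥤ V), HasSmallObjectArgument.{w} I ∧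
      I.rlp = (trivialFibrations V).functorCategory J := by
  obtain ⟨I, _, hI, -, h, -⟩ := IsCofibrantlyGenerated.exists_generators (M := V)
  refine ⟨freeMorphisms J I, inferInstance, ?_⟩
  ext F G p
  rw [freeMorphisms_rlp, h]
  rfl

lemma exists_rlp_eq_functorCategory_fibrations :
    ∃ I : MorphismProperty (J ⥤ V), HasSmallObjectArgument.{w} I ∧
      I.rlp = (fibrations V).functorCategory J := by
  obtain ⟨_, I, -, hI, -, h⟩ := IsCofibrantlyGenerated.exists_generators (M := V)
  refine ⟨freeMorphisms J I, inferInstance, ?_⟩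
  ext F G p
  rw [freeMorphisms_rlp, h]
  rfl

variable (J V)

lemma isWeakFactorizationSystem_trivialFibrations :
    IsWeakFactorizationSystem ((trivialFibrations V).functorCategory J).llp
      ((trivialFibrations V).functorCategory J) := by
  obtain ⟨I, _, h⟩ := exists_rlp_eq_functorCategory_trivialFibrations (J := J) (V := V)
  rw [← h]
  exact { rlp := rlp_llp_rlp I, llp := rfl }

lemma isWeakFactorizationSystem_fibrations :
    IsWeakFactorizationSystem ((fibrations V).functorCategory J).llp
      ((fibrations V).functorCategory J) := by
  obtain ⟨I, _, h⟩ := exists_rlp_eq_functorCategory_fibrations (J := J) (V := V)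
  rw [← h]
  exact { rlp := rlp_llp_rlp I, llp := rfl }

variable [HasLimitsOfSize.{w, w} V]

/-- The morphisms with the left lifting property against the objectwise fibrations are the trivial
cofibrations of the projective model structure. -/
lemma llp_functorCategory_fibrations :
    ((fibrations V).functorCategory J).llp =
      ((trivialFibrations V).functorCategory J).llp ⊓ (weakEquivalences V).functorCategory J := by
  have := isWeakFactorizationSystem_fibrations J V
  apply le_antisymm
  · intro F G i hi
    refine ⟨fun A B p hp => hi p (fun d => (hp d).1), fun d => ?_⟩
    have h := llp_app_of_llp_functorCategory hi d
    rw [fibrations_llp] at h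
    exact h.2
  · -- the retract argument
    rintro F G i ⟨h₁, h₂⟩
    have h := factorizationData ((fibrations V).functorCategory J).llp
      ((fibrations V).functorCategory J) i
    have h₃ : (trivialFibrations V).functorCategory J h.p := fun d => by
      refine ⟨h.hp d, ?_⟩
      have h₄ := llp_app_of_llp_functorCategory h.hi d
      rw [fibrations_llp] at h₄
      exact of_precomp _ _ _ h₄.2 (by rw [← NatTrans.comp_app, h.fac]; exact h₂ d)
    have := h₁ _ h₃
    exact of_retract (RetractArrow.ofLeftLiftingProperty h.fac) h.hi

/-- The projective model structure on a category of functors. -/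
noncomputable abbrev projectiveModelCategory : ModelCategory (J ⥤ V) :=
  letI : CategoryWithFibrations (J ⥤ V) := ⟨(fibrations V).functorCategory J⟩
  letI : CategoryWithWeakEquivalences (J ⥤ V) := ⟨(weakEquivalences V).functorCategory J⟩
  letI : CategoryWithCofibrations (J ⥤ V) := ⟨((trivialFibrations V).functorCategory J).llp⟩
  have h : trivialFibrations (J ⥤ V) = (trivialFibrations V).functorCategory J := by
    ext F G p
    exact ⟨fun h d => ⟨h.1 d, h.2 d⟩, fun h => ⟨fun d => (h d).1, fun d => (h d).2⟩⟩
  haveI : (weakEquivalences (J ⥤ V)).HasTwoOutOfThreeProperty :=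
    { comp_mem := fun f g hf hg d => (weakEquivalences V).comp_mem _ _ (hf d) (hg d)
      of_postcomp := fun f g hg hfg d => (weakEquivalences V).of_postcomp _ _ (hg d) (hfg d)
      of_precomp := fun f g hf hfg d => (weakEquivalences V).of_precomp _ _ (hf d) (hfg d) }
  haveI : IsWeakFactorizationSystem (cofibrations (J ⥤ V)) (trivialFibrations (J ⥤ V)) := by
    rw [h]
    exact isWeakFactorizationSystem_trivialFibrations J V
  haveI : IsWeakFactorizationSystem (trivialCofibrations (J ⥤ V)) (fibrations (J ⥤ V)) := by
    have := isWeakFactorizationSystem_fibrations J V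
    rw [llp_functorCategory_fibrations] at this
    exact this
  haveI : HasFiniteLimits V := inferInstance
  ModelCategory.mk' _

end Projective

section IsProjective

open MorphismProperty

variable (V : Type u) [Category.{w} V] (C : Type w) [SmallCategory.{w} C]
  [ModelCategory V] [HasLimitsOfSize.{w, w} V] [HasColimitsOfSize.{w, w} V]
  [IsCofibrantlyGenerated V]

lemma isProjective_projectiveModelCategory :
    letI := projectiveModelCategory Cᵒᵖ V
    IsProjective V C := by
  let _ := projectiveModelCategory Cᵒᵖ V
  have h₁ : weakEquivalences (Cᵒᵖ ⥤ V) = (weakEquivalences V).functorCategory Cᵒᵖ := rfl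
  have h₂ : fibrations (Cᵒᵖ ⥤ V) = (fibrations V).functorCategory Cᵒᵖ := rfl
  constructor
  · intro F G f
    simp only [weakEquivalence_iff, h₁]
    rfl
  · intro F G f
    simp only [HomotopicalAlgebra.fibration_iff, h₂]
    rfl

end IsProjective

namespace IsProjective

open MorphismProperty

variable {V : Type u} [Category.{w} V]
  {C : Type w} [SmallCategory.{w} C] [ModelCategory V] [ModelCategory (Cᵒᵖ ⥤ V)]

lemma fibrations_eq (h : IsProjective V C) :
    fibrations (Cᵒᵖ ⥤ V) = (fibrations V).functorCategory Cᵒᵖ := by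
  ext F G p
  rw [← HomotopicalAlgebra.fibration_iff, h.fibration_iff]
  simp only [HomotopicalAlgebra.fibration_iff]
  rfl

lemma trivialFibrations_eq (h : IsProjective V C) :
    trivialFibrations (Cᵒᵖ ⥤ V) = (trivialFibrations V).functorCategory Cᵒᵖ := by
  ext F G p
  rw [mem_trivialFibrations_iff, h.fibration_iff, h.weakEquivalence_iff, ← forall_and]
  simp only [← mem_trivialFibrations_iff]
  rfl

lemma cofibration_app [HasLimitsOfSize.{w, w} V] (h : IsProjective V C) {F G : Cᵒᵖ ⥤ V}
    (i : F ⟶ G) (hi : Cofibration i) (c : Cᵒᵖ) : Cofibration (i.app c) := by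
  rw [HomotopicalAlgebra.cofibration_iff, ← trivialFibrations_llp] at hi ⊢
  rw [h.trivialFibrations_eq] at hi
  exact llp_app_of_llp_functorCategory hi c

lemma isCofibrant_obj [HasLimitsOfSize.{w, w} V] [HasColimitsOfSize.{w, w} V]
    (h : IsProjective V C) (F : Cᵒᵖ ⥤ V) (hF : IsCofibrant F) (c : Cᵒᵖ) :
    IsCofibrant (F.obj c) := by
  have h₁ := h.cofibration_app (initial.to F) inferInstance c
  exact (isCofibrant_iff_of_isInitial _ (initialIsInitial.isInitialObj
    ((evaluation Cᵒᵖ V).obj c) _)).2 h₁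

variable [HasLimitsOfSize.{w, w} V] [HasColimitsOfSize.{w, w} V] [IsCofibrantlyGenerated V]

lemma isBicompleteFunctorial (h : IsProjective V C) : IsBicompleteFunctorial (Cᵒᵖ ⥤ V) where
  hasLimits := inferInstance
  hasColimits := inferInstance
  cofibration_trivialFibration := by
    obtain ⟨I, _, hI⟩ := exists_rlp_eq_functorCategory_trivialFibrations (J := Cᵒᵖ) (V := V)
    rw [← trivialFibrations_llp, h.trivialFibrations_eq, ← hI]
    infer_instance
  trivialCofibration_fibration := by
    obtain ⟨I, _, hI⟩ := exists_rlp_eq_functorCategory_fibrations (J := Cᵒᵖ) (V := V)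
    rw [← fibrations_llp, h.fibrations_eq, ← hI]
    infer_instance

end IsProjective

/-! ### Presheaves form a model `V`-category -/

section PresheafModel

variable {V : Type u} [Category.{w} V] [MonoidalCategory V] [SymmetricCategory V]
  [MonoidalClosed V] {C : Type w} [SmallCategory.{w} C]

variable (V C) in
/-- The two-variable adjunction between the objectwise tensor product and the objectwise internal
hom. -/
def presheafTensorAdjunction : presheafTensor V C ⊣₂ presheafCotensor V C where
  adj v := Adjunction.whiskerRight Cᵒᵖ (ihom.adjunction v)
  unit_whiskerRight_map f := by
    ext F c
    have := NatTrans.congr_app (MonoidalClosed.internalHomAdjunction₂.unit_whiskerRight_map f)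
      (F.obj c)
    have h (v : V) : ((Adjunction.whiskerRight Cᵒᵖ (ihom.adjunction v)).unit.app F).app c =
        (ihom.coev v).app (F.obj c) := by
      simp [Adjunction.whiskerRight]
    exact (congrArg (fun x => x ≫ _) (h _)).trans
      (this.trans (congrArg (fun x => x ≫ _) (h _)).symm)

variable [HasLimitsOfSize.{w, w} V] [HasColimitsOfSize.{w, w} V]

/-- The value at `c` of a pushout-product of a morphism of `V` and a morphism of presheaves. -/
def evaluatePushoutObjObj {v v' : V} {f : v ⟶ v'} {F G : Cᵒᵖ ⥤ V} {g : F ⟶ G}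
    (sq : (presheafTensor V C).PushoutObjObj f g) (c : Cᵒᵖ) :
    (curriedTensor V).PushoutObjObj f (g.app c) where
  pt := sq.pt.obj c
  inl := sq.inl.app c
  inr := sq.inr.app c
  isPushout := sq.isPushout.map ((evaluation Cᵒᵖ V).obj c)
  ι := sq.ι.app c
  inl_ι := NatTrans.congr_app sq.inl_ι c
  inr_ι := NatTrans.congr_app sq.inr_ι c

/-- The value at `c` of a pullback-hom of a morphism of `V` and a morphism of presheaves. -/
def evaluatePullbackObjObj {v v' : V} {f : v ⟶ v'} {F G : Cᵒᵖ ⥤ V} {g : F ⟶ G}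
    (sq : (presheafCotensor V C).PullbackObjObj f g) (c : Cᵒᵖ) :
    (MonoidalClosed.internalHom (C := V)).PullbackObjObj f (g.app c) where
  pt := sq.pt.obj c
  fst := sq.fst.app c
  snd := sq.snd.app c
  isPullback := sq.isPullback.map ((evaluation Cᵒᵖ V).obj c)
  π := sq.π.app c
  π_fst := NatTrans.congr_app sq.π_fst c
  π_snd := NatTrans.congr_app sq.π_snd c

variable [ModelCategory V] [IsSymmetricMonoidalModel V] [ModelCategory (Cᵒᵖ ⥤ V)]

/-- The pushout-product of cofibrations is a cofibration because, by adjunction, the pullback-hom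
of a cofibration of `V` and an objectwise trivial fibration is an objectwise trivial fibration.
The pushout-product is computed objectwise, and projective cofibrations are objectwise
cofibrations, so that the weak equivalences are obtained objectwise. -/
lemma pushoutProductAxiom_presheafTensor (h : IsProjective V C) :
    PushoutProductAxiom (presheafTensor V C) where
  cofibration {v v'} f {F G} g sq hf hg := by
    rw [HomotopicalAlgebra.cofibration_iff, ← trivialFibrations_llp]
    intro A B p hp
    rw [(presheafTensorAdjunction V C).hasLiftingProperty_iff sq
      (Functor.PullbackObjObj.ofHasPullback _ f p)]
    have hπ : trivialFibrations (Cᵒᵖ ⥤ V)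
        (Functor.PullbackObjObj.ofHasPullback (presheafCotensor V C) f p).π := by
      rw [h.trivialFibrations_eq] at hp ⊢
      intro c
      rw [← cofibrations_rlp]
      intro X Y i hi
      have hsq := (IsSymmetricMonoidalModel.pushoutProduct (V := V)).cofibration f i
        (Functor.PushoutObjObj.ofHasPushout _ f i) hf ⟨hi⟩
      rw [HomotopicalAlgebra.cofibration_iff, ← trivialFibrations_llp] at hsq
      exact (MonoidalClosed.internalHomAdjunction₂.hasLiftingProperty_iff
        (Functor.PushoutObjObj.ofHasPushout _ f i)
          (evaluatePullbackObjObj (Functor.PullbackObjObj.ofHasPullback _ f p) c)).1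
            (hsq _ (hp c))
    rw [HomotopicalAlgebra.cofibration_iff, ← trivialFibrations_llp] at hg
    exact hg _ hπ
  weakEquivalence {v v'} f {F G} g sq hf hg hfg := by
    rw [h.weakEquivalence_iff]
    intro c
    refine (IsSymmetricMonoidalModel.pushoutProduct (V := V)).weakEquivalence f (g.app c)
      (evaluatePushoutObjObj sq c) hf (h.cofibration_app g hg c) ?_
    rw [h.weakEquivalence_iff] at hfg
    exact hfg.imp_right (fun h' => h' c)

lemma modelVCategory_presheaf [IsCofibrantlyGenerated V]
    (h : IsProjective V C) :
    let _ := presheafTensoredCategory (V := V) (C := C)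
    ModelVCategory V (Cᵒᵖ ⥤ V) :=
  let _ := presheafTensoredCategory (V := V) (C := C)
  { isBicompleteFunctorial := h.isBicompleteFunctorial
    hasCotensors := inferInstance
    pushoutProduct := pushoutProductAxiom_presheafTensor h
    unit_tensor := fun q hQ hq F hF => (h.weakEquivalence_iff _).2 (fun c =>
      IsSymmetricMonoidalModel.unit_whiskerRight q hQ hq (F.obj c) (h.isCofibrant_obj F hF c)) }

end PresheafModel

/-! ### Left Quillen functors out of presheaf categories -/

section Tensored

variable {V : Type u} [Category.{w} V] [MonoidalCategory V] [MonoidalClosed V]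
  {M : Type u'} [Category.{w} M] [EnrichedOrdinaryCategory V M] [TensoredCategory V M]

/-- A lifting problem of `i : v ⟶ v'` against `M(m, A) ⟶ M(m, B)` is a lifting problem of
`v ⊙ m ⟶ v' ⊙ m` against `A ⟶ B`. -/
lemma hasLiftingProperty_eHomWhiskerLeft {v v' : V} (i : v ⟶ v') (m : M) {A B : M} (p : A ⟶ B)
    [HasLiftingProperty ((TensoredCategory.tensor.map i).app m) p] :
    HasLiftingProperty i (eHomWhiskerLeft V m p) := by
  have hbij (v : V) (n : M) := bijective_of_isIso_tensorComparison (TensoredCategory.unit v m) n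
  have hnat := TensoredCategory.unit_naturality_left i m
  refine ⟨fun {a b} sq => ?_⟩
  obtain ⟨a, rfl⟩ := (hbij _ _).2 a
  obtain ⟨b, rfl⟩ := (hbij _ _).2 b
  have w := sq.w
  dsimp only at w
  have sq' : CommSq a ((TensoredCategory.tensor.map i).app m) p b := ⟨by
    apply (hbij _ _).1
    dsimp only
    rw [eHomWhiskerLeft_comp, eHomWhiskerLeft_comp, ← reassoc_of% hnat, ← w, Category.assoc]⟩
  refine ⟨⟨⟨TensoredCategory.unit v' m ≫ eHomWhiskerLeft V m sq'.lift, ?_, ?_⟩⟩⟩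
  · dsimp only
    rw [reassoc_of% hnat, ← eHomWhiskerLeft_comp, sq'.fac_left]
  · dsimp only
    rw [Category.assoc, ← eHomWhiskerLeft_comp, sq'.fac_right]

variable [SymmetricCategory V]

/-- The tensor preserves initial objects in the second variable. -/
noncomputable def isInitialTensor [HasCotensors V M] (v : V) {m : M} (hm : IsInitial m) :
    IsInitial ((TensoredCategory.tensor.obj v).obj m) := by
  -- a morphism `v ⊙ m ⟶ n` corresponds to a morphism from `m` to the cotensor of `n` by `v`.
  have h (n : M) : Nonempty (Unique ((TensoredCategory.tensor.obj v).obj m ⟶ n)) := by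
    obtain ⟨c, ε, hε⟩ := HasCotensors.exists_cotensor (V := V) v n
    have h₁ := bijective_of_isIso_tensorComparison (TensoredCategory.unit v m) n
    have h₂ := bijective_of_isIso_cotensorComparison ε m
    have e := (Equiv.ofBijective _ h₁).trans (Equiv.ofBijective _ h₂).symm
    exact ⟨{ default := e.symm (hm.to c), uniq := fun f => e.injective (hm.hom_ext _ _) }⟩
  exact IsInitial.ofUniqueHom (fun n => (h n).some.default) (fun n f => (h n).some.uniq f)

variable [ModelCategory V] [ModelCategory M] [HasCotensors V M]

/-- The pushout-product of `i : v ⟶ v'` and `∅ ⟶ m` is the morphism `v ⊙ m ⟶ v' ⊙ m`. -/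
noncomputable def pushoutObjObjInitial {v v' : V} (i : v ⟶ v') (m : M) :
    (TensoredCategory.tensor (V := V) (M := M)).PushoutObjObj i (initial.to m) where
  pt := (TensoredCategory.tensor.obj v).obj m
  inl := (isInitialTensor v' initialIsInitial).to _
  inr := 𝟙 _
  isPushout := by
    have h := isInitialTensor v (initialIsInitial (C := M))
    have h' := isInitialTensor v' (initialIsInitial (C := M))
    have := isIso_of_isInitial h h' ((TensoredCategory.tensor.map i).app _)
    exact IsPushout.of_horiz_isIso ⟨h.hom_ext _ _⟩
  ι := (TensoredCategory.tensor.map i).app m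
  inl_ι := (isInitialTensor v' initialIsInitial).hom_ext _ _
  inr_ι := Category.id_comp _

variable (hM : PushoutProductAxiom (TensoredCategory.tensor (V := V) (M := M)))

include hM

/-- If `m` is cofibrant, then `v ↦ v ⊙ m` preserves cofibrations, so that `M(m, -)` preserves
trivial fibrations. -/
lemma trivialFibrations_eHomWhiskerLeft (m : M) [IsCofibrant m] {A B : M} (p : A ⟶ B)
    (hp : trivialFibrations M p) : trivialFibrations V (eHomWhiskerLeft V m p) := by
  rw [← cofibrations_rlp]
  intro v v' i hi
  have h : Cofibration ((TensoredCategory.tensor.map i).app m) :=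
    hM.cofibration i _ (pushoutObjObjInitial i m) ⟨hi⟩ inferInstance
  rw [mem_trivialFibrations_iff] at hp
  obtain ⟨_, _⟩ := hp
  exact hasLiftingProperty_eHomWhiskerLeft i m p

/-- If `m` is cofibrant, then `v ↦ v ⊙ m` preserves trivial cofibrations, so that `M(m, -)`
preserves fibrations. -/
lemma fibrations_eHomWhiskerLeft (m : M) [IsCofibrant m] {A B : M} (p : A ⟶ B)
    (hp : fibrations M p) : fibrations V (eHomWhiskerLeft V m p) := by
  rw [← trivialCofibrations_rlp]
  intro v v' i hi
  have h : Cofibration ((TensoredCategory.tensor.map i).app m) :=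
    hM.cofibration i _ (pushoutObjObjInitial i m) ⟨hi.1⟩ inferInstance
  have h' : WeakEquivalence ((TensoredCategory.tensor.map i).app m) :=
    hM.weakEquivalence i _ (pushoutObjObjInitial i m) ⟨hi.1⟩ inferInstance (Or.inl ⟨hi.2⟩)
  have : Fibration p := ⟨hp⟩
  exact hasLiftingProperty_eHomWhiskerLeft i m p

end Tensored

section Realization

variable {V : Type u} [Category.{w} V] [MonoidalCategory V] [MonoidalClosed V]
  [HasLimitsOfSize.{w, w} V] {C : Type w} [SmallCategory.{w} C] [ModelCategory (Cᵒᵖ ⥤ V)]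
  {M : Type u'} [Category.{w} M] [EnrichedOrdinaryCategory V M] [ModelCategory M]
  [SymmetricCategory V] [ModelCategory V]

/-- The realization of an objectwise cofibrant functor is a left Quillen functor, because its right
adjoint `n ↦ M(X -, n)` preserves fibrations and trivial fibrations. -/
lemma isLeftQuillen_realization [TensoredCategory V M] [HasColimitsOfSize.{w, w} M]
    [HasCotensors V M]
    (hM : PushoutProductAxiom (TensoredCategory.tensor (V := V) (M := M)))
    (hproj : IsProjective V C) (X : C ⥤ M) (hX : ∀ c, IsCofibrant (X.obj c)) :
    IsLeftQuillen (realization V X) := by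
  have hS {A B : M} (p : A ⟶ B) (c : Cᵒᵖ) :
      ((underlying (singular V X)).map p).app c = eHomWhiskerLeft V (X.obj c.unop) p :=
    homMap_singular_app X p c
  have adj := (realizationUniversalArrows (V := V) X).adjunction.toAdjunction
  refine ⟨⟨_, ⟨(realizationUniversalArrows X).adjunction⟩⟩, fun i hi => ?_, fun i hi hi' => ?_⟩
  · rw [HomotopicalAlgebra.cofibration_iff, ← trivialFibrations_llp]
    intro A B p hp
    rw [adj.hasLiftingProperty_iff]
    have h : trivialFibrations (Cᵒᵖ ⥤ V) ((underlying (singular V X)).map p) := by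
      rw [hproj.trivialFibrations_eq]
      intro c
      rw [hS]
      exact trivialFibrations_eHomWhiskerLeft hM _ p hp
    rw [mem_trivialFibrations_iff] at h
    obtain ⟨_, _⟩ := h
    infer_instance
  · suffices trivialCofibrations M ((underlying (realization V X)).map i) from ⟨this.2⟩
    rw [← fibrations_llp]
    intro A B p hp
    rw [adj.hasLiftingProperty_iff]
    have h : Fibration ((underlying (singular V X)).map p) := by
      rw [HomotopicalAlgebra.fibration_iff, hproj.fibrations_eq]
      intro c
      rw [hS]
      exact fibrations_eHomWhiskerLeft hM _ p hp
    infer_instance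

end Realization

/-! ### The category of factorizations -/

section CofibrantReplacement

variable (M : Type u') [Category.{w} M] [ModelCategory M]
  [MorphismProperty.HasFunctorialFactorization (cofibrations M) (trivialFibrations M)]

/-- The functorial factorizations into a cofibration followed by a trivial fibration. -/
noncomputable def cofibrationFactorization :
    MorphismProperty.FunctorialFactorizationData (cofibrations M) (trivialFibrations M) :=
  MorphismProperty.functorialFactorizationData _ _

/-- The functor which sends `X` to the morphism `∅ ⟶ X`. -/
noncomputable def fromInitial : M ⥤ Arrow M where
  obj X := Arrow.mk (initial.to X)
  map f := Arrow.homMk (𝟙 _) f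
  map_id X := by ext <;> simp
  map_comp f g := by ext <;> simp

/-- A functorial cofibrant replacement, given by the factorization of `∅ ⟶ X`. -/
noncomputable def cofibrantReplacement : M ⥤ M :=
  fromInitial M ⋙ (cofibrationFactorization M).Z

/-- The natural trivial fibration from the cofibrant replacement. -/
noncomputable def cofibrantReplacementπ : cofibrantReplacement M ⟶ 𝟭 M where
  app X := (cofibrationFactorization M).p.app ((fromInitial M).obj X)
  naturality _ _ f := (cofibrationFactorization M).p.naturality ((fromInitial M).map f)

variable {M}

instance isCofibrant_cofibrantReplacement (X : M) :
    IsCofibrant ((cofibrantReplacement M).obj X) :=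
  (isCofibrant_iff_of_isInitial ((cofibrationFactorization M).i.app ((fromInitial M).obj X))
    initialIsInitial).2 ⟨(cofibrationFactorization M).hi _⟩

instance weakEquivalence_cofibrantReplacementπ (X : M) :
    WeakEquivalence ((cofibrantReplacementπ M).app X) :=
  ⟨((cofibrationFactorization M).hp _).2⟩

end CofibrantReplacement

namespace Factorization

section

variable {V : Type u} [Category.{w} V] [MonoidalCategory V] [MonoidalClosed V]
  [HasLimitsOfSize.{w, w} V] [HasColimitsOfSize.{w, w} V]
  {C : Type w} [SmallCategory.{w} C] [ModelCategory (Cᵒᵖ ⥤ V)]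
  {M : Type u'} [Category.{w} M] [EnrichedOrdinaryCategory V M] [ModelCategory M] {γ : C ⥤ M}

/-- The component at `c` of the natural transformation `P.η`. It agrees by definition with
`P.η.app c`; its type mentions `P.L.obj` only. -/
def ηApp (P : Factorization V γ) (c : C) : P.L.obj ((vYoneda V C).obj c) ⟶ γ.obj c :=
  P.η.app c

lemma ηApp_naturality (P : Factorization V γ) {c d : C} (f : c ⟶ d) :
    homMap P.L ((vYoneda V C).map f) ≫ P.ηApp d = P.ηApp c ≫ γ.map f :=
  P.η.naturality f

instance (P : Factorization V γ) (c : C) : WeakEquivalence (P.ηApp c) :=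
  P.weakEquivalence c

@[simp]
lemma hom_ηApp {P P' : Factorization V γ} (f : P ⟶ P') (c : C) :
    f.τ.app ((vYoneda V C).obj c) ≫ P'.ηApp c = P.ηApp c :=
  f.w c

@[simp]
lemma comp_τ_app {P P' P'' : Factorization V γ} (f : P ⟶ P') (g : P' ⟶ P'') (F : Cᵒᵖ ⥤ V) :
    (f ≫ g).τ.app F = f.τ.app F ≫ g.τ.app F :=
  rfl

@[simp]
lemma id_τ_app (P : Factorization V γ) (F : Cᵒᵖ ⥤ V) :
    VNatTrans.app (Hom.τ (𝟙 P)) F = 𝟙 (P.L.obj F) :=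
  rfl

variable [MorphismProperty.HasFunctorialFactorization (cofibrations M) (trivialFibrations M)]

/-- The cofibrant replacement of the restriction of a factorization to the representable
presheaves. -/
noncomputable abbrev restrictionReplacement (P : Factorization V γ) : C ⥤ M where
  obj c := (cofibrantReplacement M).obj (P.L.obj ((vYoneda V C).obj c))
  map f := (cofibrantReplacement M).map (homMap P.L ((vYoneda V C).map f))
  map_id c := by simp
  map_comp f g := by simp

/-- The natural weak equivalence from the cofibrant replacement of the restriction of a
factorization of `γ` to `γ`. -/
noncomputable abbrev restrictionReplacementTo (P : Factorization V γ) :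
    P.restrictionReplacement ⟶ γ where
  app c := (cofibrantReplacementπ M).app (P.L.obj ((vYoneda V C).obj c)) ≫ P.ηApp c
  naturality c d f := by
    have h := (cofibrantReplacementπ M).naturality (homMap P.L ((vYoneda V C).map f))
    dsimp at h ⊢
    rw [reassoc_of% h, ηApp_naturality, Category.assoc]

end

end Factorization

section

variable {V : Type u} [Category.{w} V] [MonoidalCategory V] [SymmetricCategory V]
  [MonoidalClosed V] [HasLimitsOfSize.{w, w} V] [HasColimitsOfSize.{w, w} V]
  {C : Type w} [SmallCategory.{w} C]
  {M : Type u'} [Category.{w} M] [EnrichedOrdinaryCategory V M]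
  [TensoredCategory V M] [HasColimitsOfSize.{w, w} M] [HasCotensors V M]

variable (V) in
/-- The isomorphism from the realization of the representable presheaf `y c` to `X c`. -/
noncomputable def fromRealizationYoneda (X : C ⥤ M) (c : C) :
    (realization V X).obj ((vYoneda V C).obj c) ⟶ X.obj c :=
  inv (toRealizationYoneda V X c)

instance (X : C ⥤ M) (c : C) : IsIso (fromRealizationYoneda V X c) := by
  unfold fromRealizationYoneda
  infer_instance

@[simp]
lemma toRealizationYoneda_fromRealizationYoneda (X : C ⥤ M) (c : C) :
    toRealizationYoneda V X c ≫ fromRealizationYoneda V X c = 𝟙 _ :=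
  IsIso.hom_inv_id _

lemma fromRealizationYoneda_naturality (X : C ⥤ M) {c d : C} (f : c ⟶ d) :
    homMap (realization V X) ((vYoneda V C).map f) ≫ fromRealizationYoneda V X d =
      fromRealizationYoneda V X c ≫ X.map f := by
  rw [← cancel_epi (toRealizationYoneda V X c), ← reassoc_of% @toRealizationYoneda_naturality,
    toRealizationYoneda_fromRealizationYoneda,
    reassoc_of% @toRealizationYoneda_fromRealizationYoneda, Category.comp_id]

end

namespace Factorization

variable {V : Type u} [Category.{w} V] [MonoidalCategory V] [SymmetricCategory V]
  [MonoidalClosed V] [HasLimitsOfSize.{w, w} V] [HasColimitsOfSize.{w, w} V]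
  {C : Type w} [SmallCategory.{w} C] [ModelCategory V] [ModelCategory (Cᵒᵖ ⥤ V)]
  {M : Type u'} [Category.{w} M] [EnrichedOrdinaryCategory V M] [ModelCategory M]
  [TensoredCategory V M] [HasColimitsOfSize.{w, w} M] [HasCotensors V M]
  (hM : PushoutProductAxiom (TensoredCategory.tensor (V := V) (M := M)))
  (hproj : IsProjective V C) {γ : C ⥤ M}

section

/-- An objectwise cofibrant functor `X` with an objectwise weak equivalence `X ⟶ γ` gives a
factorization of `γ`, namely the realization of `X`. -/
noncomputable def ofReplacement (X : C ⥤ M) [∀ c, IsCofibrant (X.obj c)]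
    (α : X ⟶ γ) [hα : ∀ c, WeakEquivalence (α.app c)] : Factorization V γ where
  L := realization V X
  isLeftQuillen := isLeftQuillen_realization hM hproj X inferInstance
  η :=
    { app c := fromRealizationYoneda V X c ≫ α.app c
      naturality c d f := by
        change homMap (realization V X) ((vYoneda V C).map f) ≫
          fromRealizationYoneda V X d ≫ α.app d = (fromRealizationYoneda V X c ≫ α.app c) ≫ γ.map f
        rw [reassoc_of% @fromRealizationYoneda_naturality, Category.assoc, α.naturality] }
  weakEquivalence c := by
    exact (inferInstance : WeakEquivalence (fromRealizationYoneda V X c ≫ α.app c))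

variable {hM hproj} {X : C ⥤ M} [∀ c, IsCofibrant (X.obj c)] {α : X ⟶ γ}
  [hα : ∀ c, WeakEquivalence (α.app c)] {P P' : Factorization V γ}

/-- The isomorphism `X c ⟶ L (y c)`, where `L` is the realization of `X`. -/
noncomputable def toOfReplacement (c : C) :
    X.obj c ⟶ (ofReplacement hM hproj X α).L.obj ((vYoneda V C).obj c) :=
  toRealizationYoneda V X c

lemma toOfReplacement_naturality {c d : C} (f : c ⟶ d) :
    X.map f ≫ toOfReplacement (hM := hM) (hproj := hproj) (α := α) d =
      toOfReplacement c ≫ homMap (ofReplacement hM hproj X α).L ((vYoneda V C).map f) :=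
  toRealizationYoneda_naturality X f

@[simp]
lemma toOfReplacement_ηApp (c : C) :
    toOfReplacement c ≫ (ofReplacement hM hproj X α).ηApp c = α.app c := by
  change toRealizationYoneda V X c ≫ fromRealizationYoneda V X c ≫ α.app c = _
  rw [reassoc_of% @toRealizationYoneda_fromRealizationYoneda]

/-- A morphism from the realization of `X` is determined by its restriction to the representable
presheaves. -/
lemma ofReplacement_hom_ext {f g : ofReplacement hM hproj X α ⟶ P}
    (h : ∀ c, toOfReplacement c ≫ VNatTrans.app f.τ ((vYoneda V C).obj c) =
      toOfReplacement c ≫ VNatTrans.app g.τ ((vYoneda V C).obj c)) : f = g :=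
  Factorization.Hom.ext (realization_vNatTrans_ext h)

/-- The morphism from the realization of `X` induced by a natural transformation from `X` to the
restriction of `P.L` to the representable presheaves. -/
noncomputable def ofReplacementDesc (θ : ∀ c, X.obj c ⟶ P.L.obj ((vYoneda V C).obj c))
    (hθ : ∀ ⦃c d : C⦄ (h : c ⟶ d), X.map h ≫ θ d = θ c ≫ homMap P.L ((vYoneda V C).map h))
    (w : ∀ c, θ c ≫ P.ηApp c = α.app c) : ofReplacement hM hproj X α ⟶ P where
  τ := realizationDesc θ hθ
  w c := by
    change (realizationDesc θ hθ).app ((vYoneda V C).obj c) ≫ P.ηApp c =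
      fromRealizationYoneda V X c ≫ α.app c
    rw [← cancel_epi (toRealizationYoneda V X c),
      reassoc_of% @toRealizationYoneda_realizationDesc, w,
      reassoc_of% @toRealizationYoneda_fromRealizationYoneda]

@[simp]
lemma toOfReplacement_ofReplacementDesc (θ : ∀ c, X.obj c ⟶ P.L.obj ((vYoneda V C).obj c))
    (hθ : ∀ ⦃c d : C⦄ (h : c ⟶ d), X.map h ≫ θ d = θ c ≫ homMap P.L ((vYoneda V C).map h))
    (w : ∀ c, θ c ≫ P.ηApp c = α.app c) (c : C) :
    toOfReplacement c ≫
      (ofReplacementDesc (hM := hM) (hproj := hproj) θ hθ w).τ.app ((vYoneda V C).obj c) = θ c :=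
  toRealizationYoneda_realizationDesc θ hθ c

end

variable [MorphismProperty.HasFunctorialFactorization (cofibrations M) (trivialFibrations M)]

/-- The factorization given by the realization of the cofibrant replacement of the restriction of
a factorization to the representable presheaves. -/
noncomputable def replacement : Factorization V γ ⥤ Factorization V γ where
  obj P := ofReplacement hM hproj P.restrictionReplacement P.restrictionReplacementTo
  map {P P'} f := ofReplacementDesc
    (fun c => (cofibrantReplacement M).map (f.τ.app ((vYoneda V C).obj c)) ≫
      toOfReplacement (X := P'.restrictionReplacement) (α := P'.restrictionReplacementTo) c)
    (fun c d h => by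
      have h₁ := toOfReplacement_naturality (hM := hM) (hproj := hproj)
        (α := P'.restrictionReplacementTo) h
      have h₂ := f.τ.naturality_homMap ((vYoneda V C).map h)
      dsimp at h₁ ⊢
      rw [Category.assoc, ← h₁, ← Functor.map_comp_assoc, h₂, Functor.map_comp_assoc])
    (fun c => by
      have h := (cofibrantReplacementπ M).naturality (f.τ.app ((vYoneda V C).obj c))
      dsimp at h
      rw [Category.assoc, toOfReplacement_ηApp, reassoc_of% h, hom_ηApp])
  map_id P := by
    apply ofReplacement_hom_ext
    intro c
    rw [toOfReplacement_ofReplacementDesc, id_τ_app, id_τ_app, CategoryTheory.Functor.map_id,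
      Category.id_comp, Category.comp_id]
  map_comp f g := by
    apply ofReplacement_hom_ext
    intro c
    rw [toOfReplacement_ofReplacementDesc, comp_τ_app, comp_τ_app,
      reassoc_of% @toOfReplacement_ofReplacementDesc, Functor.map_comp, Category.assoc,
      Category.assoc, toOfReplacement_ofReplacementDesc]

/-- The natural morphism from the replacement of a factorization to the factorization. It is induced
by the projection from the cofibrant replacement of the restriction to this restriction. -/
noncomputable def replacementTo :
    replacement hM hproj (γ := γ) ⟶ 𝟭 (Factorization V γ) where
  app P := ofReplacementDesc
    (fun c => (cofibrantReplacementπ M).app (P.L.obj ((vYoneda V C).obj c)))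
    (fun c d h => (cofibrantReplacementπ M).naturality (homMap P.L ((vYoneda V C).map h)))
    (fun _ => rfl)
  naturality P P' f := by
    apply ofReplacement_hom_ext
    intro c
    have h := (cofibrantReplacementπ M).naturality (f.τ.app ((vYoneda V C).obj c))
    dsimp [replacement] at h ⊢
    rw [reassoc_of% @toOfReplacement_ofReplacementDesc,
      reassoc_of% @toOfReplacement_ofReplacementDesc, Category.assoc,
      toOfReplacement_ofReplacementDesc, h]

variable (γ)

/-- The factorization given by the realization of the cofibrant replacement of `γ`. -/
noncomputable def standard : Factorization V γ :=
  haveI : ∀ c, IsCofibrant ((γ ⋙ cofibrantReplacement M).obj c) :=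
    fun c => isCofibrant_cofibrantReplacement (γ.obj c)
  haveI : ∀ c, WeakEquivalence
      (NatTrans.app (Functor.whiskerLeft γ (cofibrantReplacementπ M)) c) :=
    fun c => weakEquivalence_cofibrantReplacementπ (γ.obj c)
  ofReplacement hM hproj (γ ⋙ cofibrantReplacement M)
    (Functor.whiskerLeft γ (cofibrantReplacementπ M))

/-- The isomorphism from the cofibrant replacement of `γ c` to the value of the standard
factorization at the representable presheaf `y c`. -/
noncomputable def toStandard (c : C) :
    (cofibrantReplacement M).obj (γ.obj c) ⟶
      (standard hM hproj γ).L.obj ((vYoneda V C).obj c) :=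
  toRealizationYoneda V (γ ⋙ cofibrantReplacement M) c

lemma toStandard_naturality {c d : C} (f : c ⟶ d) :
    (cofibrantReplacement M).map (γ.map f) ≫ toStandard hM hproj γ d =
      toStandard hM hproj γ c ≫ homMap (standard hM hproj γ).L ((vYoneda V C).map f) :=
  toRealizationYoneda_naturality (γ ⋙ cofibrantReplacement M) f

lemma toStandard_ηApp (c : C) :
    toStandard hM hproj γ c ≫ (standard hM hproj γ).ηApp c =
      (cofibrantReplacementπ M).app (γ.obj c) := by
  change toRealizationYoneda V (γ ⋙ cofibrantReplacement M) c ≫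
    fromRealizationYoneda V (γ ⋙ cofibrantReplacement M) c ≫ _ = _
  rw [reassoc_of% @toRealizationYoneda_fromRealizationYoneda]
  rfl

/-- The natural morphism from the replacement of a factorization to the realization of the
cofibrant replacement of `γ`. It is induced by the weak equivalence from the restriction to `γ`. -/
noncomputable def replacementToStandard :
    replacement hM hproj (γ := γ) ⟶ (Functor.const _).obj (standard hM hproj γ) where
  app P := ofReplacementDesc
    (fun c => (cofibrantReplacement M).map (P.ηApp c) ≫ toStandard hM hproj γ c)
    (fun c d h => by
      dsimp
      rw [Category.assoc, ← toStandard_naturality, ← Functor.map_comp_assoc, ηApp_naturality,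
        Functor.map_comp_assoc])
    (fun c => by
      have h := (cofibrantReplacementπ M).naturality (P.ηApp c)
      dsimp at h ⊢
      rw [Category.assoc, toStandard_ηApp, h])
  naturality P P' f := by
    apply ofReplacement_hom_ext
    intro c
    dsimp [replacement]
    rw [Category.comp_id, reassoc_of% @toOfReplacement_ofReplacementDesc, Category.assoc,
      toOfReplacement_ofReplacementDesc, toOfReplacement_ofReplacementDesc,
      ← Functor.map_comp_assoc, hom_ηApp]

end Factorization

/-! ### Products of simplices with an interval -/

section Prism

/-- The mass which a point of a standard simplex gives to the set of the `i` with `p i`. -/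
noncomputable def mass {ι : Type*} [Fintype ι] (w : stdSimplex ℝ ι) (p : ι → Prop) : ℝ := by
  classical exact ∑ i with p i, w i

section

variable {ι κ : Type*} [Fintype ι] [Fintype κ]

lemma mass_eq_sum (w : stdSimplex ℝ ι) (p : ι → Prop) [DecidablePred p] :
    mass w p = ∑ i with p i, w i := by
  unfold mass
  congr

lemma mass_map (f : ι → κ) (w : stdSimplex ℝ ι) (p : κ → Prop) :
    mass (stdSimplex.map f w) p = mass w (fun i => p (f i)) := by
  classical
  have h (k : κ) : stdSimplex.map f w k = ∑ i with f i = k, w i := by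
    rw [stdSimplex.map_coe, FunOnFinite.linearMap_apply_apply]
  simp only [mass, h]
  rw [← Finset.sum_fiberwise_of_maps_to (s := Finset.univ.filter fun i => p (f i))
    (t := Finset.univ.filter p) (g := f) (by simp)]
  refine Finset.sum_congr rfl fun k hk => Finset.sum_congr ?_ fun _ _ => rfl
  grind

lemma mass_mono (w : stdSimplex ℝ ι) {p q : ι → Prop} (h : ∀ i, p i → q i) :
    mass w p ≤ mass w q := by
  classical
  exact Finset.sum_le_sum_of_subset_of_nonneg (by grind) fun i _ _ => stdSimplex.zero_le w i

lemma mass_add_le (w : stdSimplex ℝ ι) {p q : ι → Prop} (j : ι) (hj : ¬ p j) (hj' : q j)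
    (h : ∀ i, p i → q i) : mass w p + w j ≤ mass w q := by
  classical
  unfold mass
  rw [add_comm, ← Finset.sum_insert (by simpa using hj)]
  exact Finset.sum_le_sum_of_subset_of_nonneg (by grind) fun i _ _ => stdSimplex.zero_le w i

lemma mass_congr (w : stdSimplex ℝ ι) {p q : ι → Prop} (h : ∀ i, p i ↔ q i) :
    mass w p = mass w q :=
  congrArg _ (funext fun i => propext (h i))

end

lemma mass_le_eq_add {n : ℕ} (u : stdSimplex ℝ (Fin n)) (i : Fin n) :
    mass u (· ≤ i) = mass u (· < i) + u i := by
  have : Finset.univ.filter (· ≤ i) = insert i (Finset.univ.filter (· < i)) := by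
    ext
    simp [le_iff_eq_or_lt]
  rw [mass_eq_sum, mass_eq_sum, this, Finset.sum_insert (by simp), add_comm]

lemma mass_lt_zero {n : ℕ} (u : stdSimplex ℝ (Fin (n + 1))) : mass u (· < 0) = 0 := by
  simp [mass_eq_sum]

lemma mass_lt_succ {n : ℕ} (u : stdSimplex ℝ (Fin (n + 1))) (j : Fin n) :
    mass u (· < j.succ) = mass u (· ≤ j.castSucc) :=
  mass_congr _ fun i => by simp [Fin.lt_def, Fin.le_def]

/-- A point of a standard simplex is determined by its cumulative masses. -/
lemma stdSimplex_ext_of_mass_le {n : ℕ} {v v' : stdSimplex ℝ (Fin (n + 1))}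
    (h : ∀ i, mass v (· ≤ i) = mass v' (· ≤ i)) : v = v' := by
  have h' (i : Fin (n + 1)) : mass v (· < i) = mass v' (· < i) := by
    refine Fin.cases ?_ (fun j => ?_) i
    · rw [mass_lt_zero, mass_lt_zero]
    · rw [mass_lt_succ, mass_lt_succ, h]
  apply stdSimplex.ext
  funext i
  linarith [mass_le_eq_add v i, mass_le_eq_add v' i, h i, h' i]

/-- Every point of a standard simplex is in the interior of a face. -/
lemma exists_map_eq_of_pos {m : ℕ} (w : stdSimplex ℝ (Fin (m + 1))) :
    ∃ (l : ℕ) (ι : Fin (l + 1) →o Fin (m + 1)) (w' : stdSimplex ℝ (Fin (l + 1))),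
      stdSimplex.map ι w' = w ∧ ∀ j, 0 < w' j := by
  classical
  let S : Finset (Fin (m + 1)) := Finset.univ.filter fun i => 0 < w i
  have hsum : ∑ i ∈ S, w i = 1 := by
    rw [← stdSimplex.sum_eq_one w]
    refine Finset.sum_subset (Finset.subset_univ _) fun i _ hi => ?_
    have := stdSimplex.zero_le w i
    simp only [S, Finset.mem_filter, Finset.mem_univ, true_and, not_lt] at hi
    exact le_antisymm hi this
  have hS : S.card ≠ 0 := by
    intro h
    rw [Finset.card_eq_zero] at h
    simp [h] at hsum
  obtain ⟨l, hl⟩ := Nat.exists_eq_succ_of_ne_zero hS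
  let e := S.orderEmbOfFin hl
  have he (p : Fin (m + 1) → Prop) [DecidablePred p] :
      ∑ j with p (e j), w (e j) = ∑ i ∈ S with p i, w i := by
    refine Finset.sum_bij (fun j _ => e j) ?_ ?_ ?_ ?_
    · intro j hj
      exact Finset.mem_filter.2 ⟨S.orderEmbOfFin_mem hl j, (Finset.mem_filter.1 hj).2⟩
    · intro a _ b _ h
      exact e.injective h
    · intro i hi
      have : i ∈ Set.range e := by
        rw [Finset.range_orderEmbOfFin]
        exact (Finset.mem_filter.1 hi).1
      obtain ⟨j, rfl⟩ := this
      exact ⟨j, by simpa using (Finset.mem_filter.1 hi).2, rfl⟩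
    · intro _ _
      rfl
  refine ⟨l, e.toOrderHom, ⟨fun j => w (e j), fun j => stdSimplex.zero_le w _, ?_⟩, ?_, ?_⟩
  · simpa using (he fun _ => True).trans (by simpa using hsum)
  · apply stdSimplex.ext
    funext i
    rw [stdSimplex.map_coe, FunOnFinite.linearMap_apply_apply]
    refine (he (· = i)).trans ?_
    by_cases hi : i ∈ S
    · rw [Finset.filter_eq', if_pos hi, Finset.sum_singleton]
    · rw [Finset.filter_eq', if_neg hi, Finset.sum_empty]
      have := stdSimplex.zero_le w i
      simp only [S, Finset.mem_filter, Finset.mem_univ, true_and, not_lt] at hi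
      exact (le_antisymm hi this).symm
  · intro j
    exact (Finset.mem_filter.1 (S.orderEmbOfFin_mem hl j)).2

variable {n : ℕ}

lemma val_predAbove (k : Fin n) (i : Fin (n + 1)) :
    (k.predAbove i : ℕ) = if (k : ℕ) < i then (i : ℕ) - 1 else i := by
  simp only [Fin.predAbove, Fin.lt_def, Fin.val_castSucc]
  split_ifs <;> rfl

/-- The order preserving map `[n + 1] → [1]` which sends `0, …, k` to `0` and the other elements
to `1`. -/
def cut (k : Fin (n + 1)) : Fin (n + 2) →o Fin 2 where
  toFun i := if i ≤ k.castSucc then 0 else 1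
  monotone' i j h := by
    dsimp only
    split_ifs with h₁ h₂ h₂
    · rfl
    · exact zero_le_one
    · exact (h₁ (h.trans h₂)).elim
    · rfl

lemma cut_apply (k : Fin (n + 1)) (i : Fin (n + 2)) :
    cut k i = if i ≤ k.castSucc then 0 else 1 :=
  rfl

lemma cut_le_zero_iff (k : Fin (n + 1)) (i : Fin (n + 2)) : cut k i ≤ 0 ↔ i ≤ k.castSucc := by
  by_cases h : i ≤ k.castSucc <;> simp [cut_apply, h]

/-- The `k`-th maximal simplex of the prism `Δ[n] × Δ[1]`, whose projections are `k.predAbove` and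
`cut k`, is embedded: the two projections of a point determine its cumulative masses. -/
lemma eq_of_map_predAbove_eq_of_map_cut_eq (k : Fin (n + 1)) {v v' : stdSimplex ℝ (Fin (n + 2))}
    (h₁ : stdSimplex.map k.predAbove v = stdSimplex.map k.predAbove v')
    (h₂ : stdSimplex.map (cut k) v = stdSimplex.map (cut k) v') : v = v' := by
  apply stdSimplex_ext_of_mass_le
  intro i
  obtain hi | rfl | hi := lt_trichotomy i k.castSucc
  · have (u : stdSimplex ℝ (Fin (n + 2))) : mass u (· ≤ i) =
        mass (stdSimplex.map k.predAbove u) (· ≤ k.predAbove i) := by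
      rw [mass_map]
      refine mass_congr _ fun j => ?_
      simp only [Fin.le_def, Fin.lt_def, val_predAbove, Fin.val_castSucc] at hi ⊢
      split_ifs <;> omega
    rw [this, h₁, ← this]
  · have (u : stdSimplex ℝ (Fin (n + 2))) : mass u (· ≤ k.castSucc) =
        mass (stdSimplex.map (cut k) u) (· ≤ 0) := by
      rw [mass_map]
      exact mass_congr _ fun j => (cut_le_zero_iff k j).symm
    rw [this, h₂, ← this]
  · have (u : stdSimplex ℝ (Fin (n + 2))) : mass u (· ≤ i) =
        mass (stdSimplex.map k.predAbove u) (· ≤ k.predAbove i) := by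
      rw [mass_map]
      refine mass_congr _ fun j => ?_
      simp only [Fin.le_def, Fin.lt_def, val_predAbove, Fin.val_castSucc] at hi ⊢
      split_ifs <;> omega
    rw [this, h₁, ← this]

/-- The maximal simplices `(k.predAbove, cut k) : Δ[n + 1] ⟶ Δ[n] × Δ[1]` cover the prism. -/
lemma exists_map_predAbove_eq_map_cut_eq (t : stdSimplex ℝ (Fin (n + 1)))
    (s : stdSimplex ℝ (Fin 2)) :
    ∃ (k : Fin (n + 1)) (v : stdSimplex ℝ (Fin (n + 2))),
      stdSimplex.map k.predAbove v = t ∧ stdSimplex.map (cut k) v = s := by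
  have hlast : s 0 ≤ mass t (· ≤ Fin.last n) := by
    rw [mass_congr t (q := fun _ => True) fun i => iff_true_intro (Fin.le_last i)]
    simp [mass_eq_sum]
  -- `k` is the first index at which the cumulative mass of `t` exceeds `s 0`
  obtain ⟨k, hk, hmin⟩ := exists_minimal_of_wellFoundedLT (fun k => s 0 ≤ mass t (· ≤ k)) ⟨_, hlast⟩
  have hk' : mass t (· < k) ≤ s 0 := by
    obtain rfl | ⟨j, rfl⟩ := Fin.eq_zero_or_eq_succ k
    · exact (mass_lt_zero t).trans_le (stdSimplex.zero_le s 0)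
    · rw [mass_lt_succ]
      by_contra! h
      exact absurd (hmin h.le j.castSucc_lt_succ.le) (by simp [Fin.le_def])
  have ht := mass_le_eq_add t k
  -- the weight `t k` is divided between the vertices `(k, 0)` and `(k, 1)`, so that the mass of the
  -- vertices `(i, 0)` becomes `s 0`
  let a := s 0 - mass t (· < k)
  let v : Fin (n + 2) → ℝ := k.castSucc.insertNth a (Function.update t k (t k - a))
  have hv (p : Fin (n + 2) → Prop) [DecidablePred p] : ∑ x with p x, v x =
      mass t (fun j => p (k.castSucc.succAbove j)) + (if p k.castSucc then a else 0) -
        if p k.succ then a else 0 := by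
    have h (j : Fin (n + 1)) : Function.update t k (t k - a) j = t j - if j = k then a else 0 := by
      by_cases hj : j = k
      · subst hj
        simp
      · simp [hj]
    have h' (j : Fin (n + 1)) : (if p (k.castSucc.succAbove j) then
        t j - (if j = k then a else 0) else 0) = (if p (k.castSucc.succAbove j) then t j else 0) -
          if j = k then (if p k.succ then a else 0) else 0 := by
      by_cases hj : j = k
      · subst hj
        simp only [Fin.succAbove_castSucc_self, if_true]
        split_ifs <;> ring
      · simp [hj]
    rw [Finset.sum_filter, Fin.sum_univ_succAbove _ k.castSucc]
    simp only [v, Fin.insertNth_apply_same, Fin.insertNth_apply_succAbove, h, h']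
    rw [Finset.sum_sub_distrib, Finset.sum_ite_eq' Finset.univ k, if_pos (Finset.mem_univ k),
      mass_eq_sum, Finset.sum_filter]
    ring
  have hv_mem : v ∈ stdSimplex ℝ (Fin (n + 2)) := by
    refine ⟨fun x => ?_, ?_⟩
    · induction x using k.castSucc.succAboveCases with
      | x =>
        simp only [v, Fin.insertNth_apply_same, a]
        linarith
      | p j =>
        simp only [v, Fin.insertNth_apply_succAbove]
        by_cases hj : j = k
        · subst hj
          simp only [Function.update_self, a]
          linarith
        · simp [hj]
    · have := hv fun _ => True
      simp only [Finset.filter_true, if_true] at this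
      rw [this, mass_eq_sum]
      simp
  have hmass (p : Fin (n + 2) → Prop) [DecidablePred p] :
      mass (⟨v, hv_mem⟩ : stdSimplex ℝ (Fin (n + 2))) p =
        mass t (fun j => p (k.castSucc.succAbove j)) + (if p k.castSucc then a else 0) -
          if p k.succ then a else 0 :=
    (mass_eq_sum _ p).trans (hv p)
  refine ⟨k, ⟨v, hv_mem⟩, ?_, ?_⟩
  · apply stdSimplex_ext_of_mass_le
    intro i
    rw [mass_map, hmass]
    simp
  · apply stdSimplex_ext_of_mass_le
    have h0 : mass (stdSimplex.map (cut k) (⟨v, hv_mem⟩ : stdSimplex ℝ (Fin (n + 2)))) (· ≤ 0) =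
        mass s (· ≤ 0) := by
      rw [mass_map, mass_le_eq_add s, mass_lt_zero, zero_add,
        mass_congr _ (cut_le_zero_iff k), hmass, if_pos le_rfl,
        if_neg (by simp [Fin.le_def]), mass_congr t (q := (· < k)), sub_zero]
      · simp [a]
      · intro j
        simp only [Fin.succAbove, Fin.lt_def, Fin.le_def, Fin.val_castSucc]
        split_ifs <;> simp
        omega
    have h1 (u : stdSimplex ℝ (Fin 2)) : mass u (· ≤ 1) = 1 := by
      refine (mass_congr u fun i => iff_true_intro (Fin.le_last i)).trans ?_
      simp [mass_eq_sum]
    intro i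
    fin_cases i
    · exact h0
    · exact (h1 _).trans (h1 s).symm

/-- A chain in `[n] × [1]`, with positive weights which define the same point of the prism as a
point of its `k`-th simplex, is contained in the `k`-th maximal chain. -/
lemma exists_predAbove_comp_eq_cut_comp_eq {m : ℕ} (φ : Fin (m + 1) →o Fin (n + 1))
    (χ : Fin (m + 1) →o Fin 2) (w : stdSimplex ℝ (Fin (m + 1))) (hw : ∀ j, 0 < w j)
    (k : Fin (n + 1)) (v : stdSimplex ℝ (Fin (n + 2)))
    (h₁ : stdSimplex.map k.predAbove v = stdSimplex.map φ w)
    (h₂ : stdSimplex.map (cut k) v = stdSimplex.map χ w) :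
    ∃ ψ : Fin (m + 1) →o Fin (n + 2), (∀ j, k.predAbove (ψ j) = φ j) ∧
      (∀ j, cut k (ψ j) = χ j) ∧ stdSimplex.map ψ w = v := by
  have hs : mass w (χ · ≤ 0) = mass v (· ≤ k.castSucc) := by
    rw [← mass_map (p := (· ≤ 0)), ← h₂, mass_map]
    exact mass_congr _ fun j => cut_le_zero_iff k j
  have ht (p : Fin (n + 1) → Prop) : mass w (fun j => p (φ j)) =
      mass v (fun i => p (k.predAbove i)) := by
    rw [← mass_map (p := p), ← h₁, mass_map]
  have hχ (j) : χ j = 0 ∨ χ j = 1 := by omega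
  -- otherwise the initial segment `φ ≤ k` would be strictly contained in `χ = 0`, although its mass
  -- is at least the mass of `χ = 0`
  have h0 (j) (hj : χ j = 0) : φ j ≤ k := by
    by_contra! hk
    have h := mass_add_le w (p := (φ · ≤ k)) (q := (χ · ≤ 0)) j (by simpa using hk) hj.le
      fun i hi => (χ.monotone (φ.monotone.reflect_lt (hi.trans_lt hk)).le).trans hj.le
    rw [ht (· ≤ k), hs] at h
    have h' := mass_mono v (p := (· ≤ k.castSucc)) (q := fun i => k.predAbove i ≤ k)
      (by
        intro i hi
        simp only [Fin.le_def, val_predAbove, Fin.val_castSucc] at hi ⊢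
        split_ifs <;> omega)
    linarith [hw j]
  -- otherwise `χ = 0` would be strictly contained in the initial segment `φ < k`, although its mass
  -- is at least the mass of `φ < k`
  have h1 (j) (hj : χ j = 1) : k ≤ φ j := by
    by_contra! hk
    have h := mass_add_le w (p := (χ · ≤ 0)) (q := (φ · < k)) j (by simp [hj]) hk
      fun i hi => (φ.monotone (χ.monotone.reflect_lt
        (hi.trans_lt (by simp [hj]))).le).trans_lt hk
    rw [ht (· < k), hs] at h
    have h' := mass_mono v (p := fun i => k.predAbove i < k) (q := (· ≤ k.castSucc)) (by
      intro i hi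
      simp only [Fin.le_def, Fin.lt_def, val_predAbove, Fin.val_castSucc] at hi ⊢
      split_ifs at hi <;> omega)
    linarith [hw j]
  let ψ : Fin (m + 1) →o Fin (n + 2) :=
    { toFun j := if χ j = 0 then (φ j).castSucc else (φ j).succ
      monotone' i j h := by
        have h₁ := φ.monotone h
        have h₂ := χ.monotone h
        dsimp only
        simp only [Fin.le_def] at h₁ h₂
        split_ifs with h₃ h₄ h₄ <;> simp only [Fin.le_def, Fin.val_castSucc, Fin.val_succ]
        · omega
        · omega
        · rw [h₄, Fin.val_zero, (hχ i).resolve_left h₃] at h₂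
          exact absurd h₂ (by decide)
        · omega }
  have hψ (j) : ψ j = if χ j = 0 then (φ j).castSucc else (φ j).succ := rfl
  have hψ₁ (j) : k.predAbove (ψ j) = φ j := by
    obtain hj | hj := hχ j
    · rw [hψ, if_pos hj, Fin.predAbove_castSucc_of_le _ _ (h0 j hj)]
    · rw [hψ, if_neg (by simp [hj]), Fin.predAbove_succ_of_le _ _ (h1 j hj)]
  have hψ₂ (j) : cut k (ψ j) = χ j := by
    obtain hj | hj := hχ j
    · simpa [hψ, hj, cut_apply] using h0 j hj
    · simpa [hψ, hj, cut_apply] using h1 j hj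
  refine ⟨ψ, hψ₁, hψ₂, eq_of_map_predAbove_eq_of_map_cut_eq k ?_ ?_⟩
  · rw [h₁, stdSimplex.map_comp_apply]
    exact congrArg (fun f => stdSimplex.map f w) (funext hψ₁)
  · rw [h₂, stdSimplex.map_comp_apply]
    exact congrArg (fun f => stdSimplex.map f w) (funext hψ₂)

end Prism

/-! ### The geometric realization of a simplicial homotopy -/

section Realization

open Simplicial

lemma stdSimplex_map_const {ι κ : Type*} [Fintype ι] [Fintype κ] [DecidableEq κ] (k : κ)
    (w : stdSimplex ℝ ι) : stdSimplex.map (fun _ => k) w = stdSimplex.vertex k := by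
  apply stdSimplex.ext
  funext j
  rw [stdSimplex.map_coe, FunOnFinite.linearMap_apply_apply, stdSimplex.vertex_coe]
  by_cases h : k = j
  · subst h
    simp
  · rw [Finset.filter_false_of_mem (by simp [h]), Finset.sum_empty, Pi.single_eq_of_ne' h]

/-- The characteristic map of a simplex, with values in the realization. -/
noncomputable def characteristic (Y : SSet.{u}) {n : SimplexCategory} (y : Y.obj (op n)) :
    C(stdSimplex ℝ (Fin (n.len + 1)), SSet.toTop.obj Y) :=
  TopCat.toSSetObjEquiv _ (op n) ((sSetTopAdj.unit.app Y).app (op n) y)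

lemma characteristic_map (Y : SSet.{u}) {m n : SimplexCategory} (f : m ⟶ n) (y : Y.obj (op n))
    (v : stdSimplex ℝ (Fin (m.len + 1))) :
    characteristic Y (Y.map f.op y) v = characteristic Y y (stdSimplex.map f v) := by
  have h := ConcreteCategory.congr_hom ((sSetTopAdj.unit.app Y).naturality f.op) y
  exact congrArg (fun z => TopCat.toSSetObjEquiv _ (op m) z v) h

/-- The space of the paths, parametrized by the standard simplex of dimension `1`, in the
realization of a simplicial set. -/
noncomputable abbrev pathSpace (Y : SSet.{u}) : TopCat.{u} :=
  TopCat.of C(stdSimplex ℝ (Fin 2), SSet.toTop.obj Y)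

/-- A simplicial homotopy, that is a morphism `X × Δ[1] ⟶ Y`, given by its action on simplices. -/
structure SimplicialHomotopy (X Y : SSet.{u}) where
  app {n : SimplexCategory} (χ : n ⟶ ⦋1⦌) (x : X.obj (op n)) : Y.obj (op n)
  naturality {m n : SimplexCategory} (f : m ⟶ n) (χ : n ⟶ ⦋1⦌) (x : X.obj (op n)) :
    app (f ≫ χ) (X.map f.op x) = Y.map f.op (app χ x)

namespace SimplicialHomotopy

variable {X Y : SSet.{u}} (H : SimplicialHomotopy X Y)

/-- The value of a simplicial homotopy at a point of a simplex of a prism does not change if this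
point is considered in a face or in a degeneracy of this simplex. -/
lemma characteristic_app_map {l m n : SimplexCategory} (x : X.obj (op n)) (g : l ⟶ m) (φ : m ⟶ n)
    (χ : m ⟶ ⦋1⦌) (u : stdSimplex ℝ (Fin (l.len + 1))) :
    characteristic Y (H.app χ (X.map φ.op x)) (stdSimplex.map g u) =
      characteristic Y (H.app (g ≫ χ) (X.map (g ≫ φ).op x)) u := by
  rw [← characteristic_map, ← H.naturality, op_comp, X.map_comp]
  rfl

/-- The value of a simplicial homotopy at a point of a prism does not depend on the simplex of the
prism in which this point is represented. -/
lemma characteristic_app_eq {n m m' : SimplexCategory} (x : X.obj (op n)) (φ : m ⟶ n)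
    (χ : m ⟶ ⦋1⦌) (w : stdSimplex ℝ (Fin (m.len + 1))) (φ' : m' ⟶ n) (χ' : m' ⟶ ⦋1⦌)
    (w' : stdSimplex ℝ (Fin (m'.len + 1)))
    (h₁ : stdSimplex.map φ w = stdSimplex.map φ' w')
    (h₂ : stdSimplex.map χ w = stdSimplex.map χ' w') :
    characteristic Y (H.app χ (X.map φ.op x)) w =
      characteristic Y (H.app χ' (X.map φ'.op x)) w' := by
  obtain ⟨k, v, hv₁, hv₂⟩ :=
    exists_map_predAbove_eq_map_cut_eq (stdSimplex.map φ w) (stdSimplex.map χ w)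
  have key {l : SimplexCategory} (φ : l ⟶ n) (χ : l ⟶ ⦋1⦌) (w : stdSimplex ℝ (Fin (l.len + 1)))
      (h₁ : stdSimplex.map k.predAbove v = stdSimplex.map φ w)
      (h₂ : stdSimplex.map (cut k) v = stdSimplex.map χ w) :
      characteristic Y (H.app χ (X.map φ.op x)) w =
        characteristic Y (H.app (n := ⦋n.len + 1⦌) (SimplexCategory.mkHom (cut k))
          (X.map (SimplexCategory.σ k).op x)) v := by
    -- after passing to a face, the weights are positive
    obtain ⟨p, ι, u, rfl, hu⟩ := exists_map_eq_of_pos w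
    let ι' : ⦋p⦌ ⟶ l := SimplexCategory.Hom.mk ι
    rw [stdSimplex.map_comp_apply] at h₁ h₂
    obtain ⟨ψ, hψ₁, hψ₂, rfl⟩ := exists_predAbove_comp_eq_cut_comp_eq (ι' ≫ φ).toOrderHom
      (ι' ≫ χ).toOrderHom u hu k v h₁ h₂
    let ψ' : ⦋p⦌ ⟶ ⦋n.len + 1⦌ := SimplexCategory.Hom.mk ψ
    have h₁' : ψ' ≫ SimplexCategory.σ k = ι' ≫ φ := by
      ext j : 3
      exact hψ₁ j
    have h₂' : ψ' ≫ SimplexCategory.mkHom (cut k) = ι' ≫ χ := by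
      ext j : 3
      exact hψ₂ j
    refine (H.characteristic_app_map x ι' φ χ u).trans (Eq.trans ?_
      (H.characteristic_app_map x ψ' (SimplexCategory.σ k) (SimplexCategory.mkHom (cut k)) u).symm)
    rw [h₁', h₂']
  rw [key φ χ w hv₁ hv₂, key φ' χ' w' (hv₁.trans h₁) (hv₂.trans h₂)]

/-- The projection from the disjoint union of the maximal simplices of a prism to this prism. -/
noncomputable def prismProjection (n : ℕ) (p : Fin (n + 1) × stdSimplex ℝ (Fin (n + 2))) :
    stdSimplex ℝ (Fin (n + 1)) × stdSimplex ℝ (Fin 2) :=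
  (stdSimplex.map p.1.predAbove p.2, stdSimplex.map (cut p.1) p.2)

/-- The prism has the quotient topology, because it is the image of a compact space. -/
lemma isQuotientMap_prismProjection (n : ℕ) : Topology.IsQuotientMap (prismProjection n) := by
  have hc : Continuous (prismProjection n) := by
    refine continuous_prod_of_discrete_left.2 fun k => ?_
    have h₁ : Continuous (stdSimplex.map (S := ℝ) k.predAbove) := stdSimplex.continuous_map _
    have h₂ : Continuous (stdSimplex.map (S := ℝ) (cut k)) := stdSimplex.continuous_map _
    exact h₁.prodMk h₂
  have hs : Function.Surjective (prismProjection n) := fun p => by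
    obtain ⟨k, v, h₁, h₂⟩ := exists_map_predAbove_eq_map_cut_eq p.1 p.2
    exact ⟨(k, v), Prod.ext h₁ h₂⟩
  have : CompactSpace (Fin (n + 1) × stdSimplex ℝ (Fin (n + 2))) := inferInstance
  have : T2Space (stdSimplex ℝ (Fin (n + 1)) × stdSimplex ℝ (Fin 2)) := inferInstance
  exact hc.isClosedMap.isQuotientMap hc hs

/-- The map from the topological prism over a simplex given by a simplicial homotopy. It is defined
at a point by means of any maximal simplex of the prism which contains this point. -/
noncomputable def prismFun {n : SimplexCategory} (x : X.obj (op n))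
    (p : stdSimplex ℝ (Fin (n.len + 1)) × stdSimplex ℝ (Fin 2)) : SSet.toTop.obj Y :=
  let q := (isQuotientMap_prismProjection n.len).surjective.hasRightInverse.choose p
  characteristic Y (H.app (n := ⦋n.len + 1⦌) (SimplexCategory.mkHom (cut q.1))
    (X.map (SimplexCategory.σ q.1).op x)) q.2

lemma prismFun_eq {m n : SimplexCategory} (x : X.obj (op n)) (φ : m ⟶ n) (χ : m ⟶ ⦋1⦌)
    (w : stdSimplex ℝ (Fin (m.len + 1))) :
    H.prismFun x (stdSimplex.map φ w, stdSimplex.map χ w) =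
      characteristic Y (H.app χ (X.map φ.op x)) w := by
  have h := (isQuotientMap_prismProjection n.len).surjective.hasRightInverse.choose_spec
    (stdSimplex.map φ w, stdSimplex.map χ w)
  exact H.characteristic_app_eq _ _ _ _ _ _ _ (congrArg Prod.fst h) (congrArg Prod.snd h)

/-- Every point of a prism is in a simplex of the product of a standard simplex and `Δ[1]`. -/
lemma exists_prism_eq {n : SimplexCategory}
    (p : stdSimplex ℝ (Fin (n.len + 1)) × stdSimplex ℝ (Fin 2)) :
    ∃ (m : SimplexCategory) (φ : m ⟶ n) (χ : m ⟶ ⦋1⦌) (w : stdSimplex ℝ (Fin (m.len + 1))),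
      p = (stdSimplex.map φ w, stdSimplex.map χ w) := by
  obtain ⟨k, v, h₁, h₂⟩ := exists_map_predAbove_eq_map_cut_eq p.1 p.2
  exact ⟨⦋n.len + 1⦌, SimplexCategory.σ k, SimplexCategory.mkHom (cut k), v,
    Prod.ext h₁.symm h₂.symm⟩

/-- The continuous map from the topological prism over a simplex given by a simplicial homotopy. -/
noncomputable def prismMap {n : SimplexCategory} (x : X.obj (op n)) :
    C(stdSimplex ℝ (Fin (n.len + 1)), pathSpace Y) :=
  ContinuousMap.curry ⟨H.prismFun x, by
    refine (isQuotientMap_prismProjection n.len).continuous_iff.2 ?_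
    refine continuous_prod_of_discrete_left.2 fun k => ?_
    exact (ContinuousMap.continuous _).congr fun v =>
      (H.prismFun_eq x (SimplexCategory.σ k) (SimplexCategory.mkHom (cut k)) v).symm⟩

lemma prismMap_eq {m n : SimplexCategory} (x : X.obj (op n)) (φ : m ⟶ n) (χ : m ⟶ ⦋1⦌)
    (w : stdSimplex ℝ (Fin (m.len + 1))) :
    H.prismMap x (stdSimplex.map φ w) (stdSimplex.map χ w) =
      characteristic Y (H.app χ (X.map φ.op x)) w :=
  H.prismFun_eq x φ χ w

lemma prismMap_map {m n : SimplexCategory} (f : m ⟶ n) (x : X.obj (op n))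
    (t : stdSimplex ℝ (Fin (m.len + 1))) :
    H.prismMap (X.map f.op x) t = H.prismMap x (stdSimplex.map f t) := by
  ext s
  obtain ⟨l, φ, χ, w, h⟩ := exists_prism_eq (t, s)
  obtain ⟨rfl, rfl⟩ := Prod.ext_iff.1 h
  dsimp only
  rw [prismMap_eq, stdSimplex.map_comp_apply]
  refine Eq.trans ?_ (H.prismMap_eq x (φ ≫ f) χ w).symm
  rw [op_comp, X.map_comp]
  rfl

/-- The morphism from `X` to the singular simplicial set of the space of paths in the realization
of `Y` given by a simplicial homotopy. -/
noncomputable def toSingularPaths :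
    X ⟶ TopCat.toSSet.obj (pathSpace Y) where
  app n := ↾fun x => (TopCat.toSSetObjEquiv _ n).symm (H.prismMap (n := n.unop) x)
  naturality m n f := by
    ext x
    have h : H.prismMap (X.map f.unop.op x) =
        (H.prismMap x).comp ⟨stdSimplex.map f.unop, stdSimplex.continuous_map _⟩ :=
      ContinuousMap.ext fun t => H.prismMap_map f.unop x t
    exact congrArg (TopCat.toSSetObjEquiv (pathSpace Y) (op n.unop)).symm h

/-- The homotopy between realizations given by a simplicial homotopy. -/
noncomputable def realization :
    C(SSet.toTop.obj X, C(stdSimplex ℝ (Fin 2), SSet.toTop.obj Y)) :=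
  ((sSetTopAdj.homEquiv X _).symm H.toSingularPaths).hom

/-- At the vertices of the interval, the realization of a simplicial homotopy is given by the
realizations of the restrictions of this homotopy. -/
lemma realization_vertex (i : Fin 2) (g : X ⟶ Y)
    (hg : ∀ (n : SimplexCategory) (x : X.obj (op n)),
      H.app (SimplexCategory.const n ⦋1⦌ i) x = g.app (op n) x) (z : SSet.toTop.obj X) :
    H.realization z (stdSimplex.vertex i) = SSet.toTop.map g z := by
  let ev : pathSpace Y ⟶ SSet.toTop.obj Y :=
    TopCat.ofHom ⟨fun f => f (stdSimplex.vertex i), by fun_prop⟩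
  have h : (sSetTopAdj.homEquiv X _).symm H.toSingularPaths ≫ ev = SSet.toTop.map g := by
    apply (sSetTopAdj.homEquiv X _).injective
    rw [Adjunction.homEquiv_naturality_right, Equiv.apply_symm_apply, Adjunction.homEquiv_unit]
    refine Eq.trans ?_ (sSetTopAdj.unit.naturality g)
    ext n x
    apply (TopCat.toSSetObjEquiv _ n).injective
    ext t
    have h := H.prismMap_eq x (𝟙 n.unop) (SimplexCategory.const n.unop ⦋1⦌ i) t
    have h₁ : stdSimplex.map (𝟙 n.unop : n.unop ⟶ n.unop) t = t := stdSimplex.map_id_apply t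
    have h₂ : stdSimplex.map (SimplexCategory.const n.unop ⦋1⦌ i) t = stdSimplex.vertex i :=
      stdSimplex_map_const i t
    rw [h₁, h₂, op_id, X.map_id] at h
    exact h.trans (congrArg (fun y => characteristic Y y t) (hg n.unop x))
  exact ConcreteCategory.congr_hom h z

end SimplicialHomotopy

end Realization

/-! ### Contractible categories -/

section Nerve

open Simplicial

/-- The realization of a simplicial homotopy is a homotopy. -/
lemma SimplicialHomotopy.homotopic {X Y : SSet.{u}} (H : SimplicialHomotopy X Y) (g₀ g₁ : X ⟶ Y)
    (h₀ : ∀ (n : SimplexCategory) (x : X.obj (op n)),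
      H.app (SimplexCategory.const n ⦋1⦌ 0) x = g₀.app (op n) x)
    (h₁ : ∀ (n : SimplexCategory) (x : X.obj (op n)),
      H.app (SimplexCategory.const n ⦋1⦌ 1) x = g₁.app (op n) x) :
    ContinuousMap.Homotopic (SSet.toTop.map g₀).hom (SSet.toTop.map g₁).hom :=
  ⟨{ toFun p := H.realization p.2 (stdSimplexHomeomorphUnitInterval.symm p.1)
     continuous_toFun := by fun_prop
     map_zero_left z := by
       have h : stdSimplexHomeomorphUnitInterval.symm 0 = stdSimplex.vertex 0 := by
         rw [Homeomorph.symm_apply_eq, stdSimplexHomeomorphUnitInterval_zero]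
       rw [h]
       exact H.realization_vertex 0 g₀ h₀ z
     map_one_left z := by
       have h : stdSimplexHomeomorphUnitInterval.symm 1 = stdSimplex.vertex 1 := by
         rw [Homeomorph.symm_apply_eq, stdSimplexHomeomorphUnitInterval_one]
       rw [h]
       exact H.realization_vertex 1 g₁ h₁ z }⟩

variable {D : Type u} [Category.{v₁} D]

/-- The simplicial homotopy between the nerves of two functors given by a natural
transformation. -/
noncomputable def nerveHomotopy {F G : D ⥤ D} (α : F ⟶ G) :
    SimplicialHomotopy (nerve D) (nerve D) where
  app χ x := χ.toOrderHom.monotone.functor.prod' x ⋙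
    Functor.uncurry.obj (ComposableArrows.mk₁ α)
  naturality _ _ _ := rfl

lemma homotopic_toTop_nerveMap {F G : D ⥤ D} (α : F ⟶ G) :
    ContinuousMap.Homotopic (SSet.toTop.map (nerveMap F)).hom
      (SSet.toTop.map (nerveMap G)).hom := by
  refine (nerveHomotopy α).homotopic _ _ (fun n x => ?_) (fun n x => ?_)
  · refine CategoryTheory.Functor.ext (fun _ => rfl) fun i j f => ?_
    change 𝟙 (F.obj (x.obj i)) ≫ F.map (x.map f) =
      𝟙 (F.obj (x.obj i)) ≫ F.map (x.map f) ≫ 𝟙 (F.obj (x.obj j))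
    rw [Category.comp_id]
  · refine CategoryTheory.Functor.ext (fun _ => rfl) fun i j f => ?_
    change 𝟙 (G.obj (x.obj i)) ≫ G.map (x.map f) =
      𝟙 (G.obj (x.obj i)) ≫ G.map (x.map f) ≫ 𝟙 (G.obj (x.obj j))
    rw [Category.comp_id]

/-- The realization of the nerve of a constant functor is constant. -/
lemma toTop_nerveMap_const (K : D) (z : SSet.toTop.obj (nerve D)) :
    SSet.toTop.map (nerveMap ((Functor.const D).obj K)) z =
      characteristic (nerve D) (n := ⦋0⦌) (ComposableArrows.mk₀ K) default := by
  let c : TopCat.of (SSet.toTop.obj (nerve D)) ⟶ TopCat.of (SSet.toTop.obj (nerve D)) :=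
    TopCat.ofHom (ContinuousMap.const _
      (characteristic (nerve D) (n := ⦋0⦌) (ComposableArrows.mk₀ K) default))
  have h : SSet.toTop.map (nerveMap ((Functor.const D).obj K)) = c := by
    apply (sSetTopAdj.homEquiv _ _).injective
    rw [Adjunction.homEquiv_unit, Adjunction.homEquiv_unit]
    refine (sSetTopAdj.unit.naturality (nerveMap ((Functor.const D).obj K))).symm.trans ?_
    ext n x
    apply (TopCat.toSSetObjEquiv _ n).injective
    ext t
    refine (characteristic_map (nerve D) (SimplexCategory.const n.unop ⦋0⦌ 0)
      (ComposableArrows.mk₀ K) t).trans ?_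
    exact congrArg _ (Subsingleton.elim _ _)
  exact ConcreteCategory.congr_hom h z

/-- A category `D` is contractible as soon as its identity functor is related to a constant functor
by a zigzag of natural transformations. -/
lemma isContractible_of_zigzag (F : D ⥤ D) (K : D) (α : F ⟶ 𝟭 D)
    (β : F ⟶ (Functor.const D).obj K) : IsContractible D := by
  refine (contractible_iff_id_nullhomotopic _).2
    ⟨characteristic (nerve D) (n := ⦋0⦌) (ComposableArrows.mk₀ K) default, ?_⟩
  have h := (homotopic_toTop_nerveMap α).symm.trans (homotopic_toTop_nerveMap β)
  have h₁ : (SSet.toTop.map (nerveMap (𝟭 D))).hom = ContinuousMap.id _ :=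
    congrArg TopCat.Hom.hom (SSet.toTop.map_id (nerve D))
  rw [h₁] at h
  convert h using 1
  ext z
  exact (toTop_nerveMap_const K z).symm

end Nerve

end EnrichedModel

/-! ### Universality of the Yoneda embedding -/

theorem mainTheorem4
    {V : Type u} [Category.{w} V] [MonoidalCategory V] [SymmetricCategory V] [MonoidalClosed V]
    [HasLimitsOfSize.{w, w} V] [HasColimitsOfSize.{w, w} V]
    [ModelCategory V] [EnrichedModel.IsSymmetricMonoidalModel V]
    [EnrichedModel.IsCofibrantlyGenerated V] (hunit : IsCofibrant (𝟙_ V))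
    (C : Type w) [SmallCategory.{w} C] :
    ∃ (_ : ModelCategory (Cᵒᵖ ⥤ V)) (_ : EnrichedModel.TensoredCategory V (Cᵒᵖ ⥤ V)),
      EnrichedModel.IsProjective V C ∧
      EnrichedModel.ModelVCategory V (Cᵒᵖ ⥤ V) ∧
      ∀ (M : Type u') [Category.{w} M] [EnrichedOrdinaryCategory V M] [ModelCategory M]
        [EnrichedModel.TensoredCategory V M] [EnrichedModel.ModelVCategory V M] (γ : C ⥤ M),
        EnrichedModel.IsContractible (EnrichedModel.Factorization V γ) := by
  let _ := EnrichedModel.projectiveModelCategory Cᵒᵖ V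
  have hproj : EnrichedModel.IsProjective V C :=
    EnrichedModel.isProjective_projectiveModelCategory V C
  refine ⟨inferInstance, EnrichedModel.presheafTensoredCategory, hproj,
    EnrichedModel.modelVCategory_presheaf hproj, ?_⟩
  intro M _ _ _ _ hM γ
  have := hM.hasCotensors
  have := hM.isBicompleteFunctorial.hasColimits
  have := hM.isBicompleteFunctorial.cofibration_trivialFibration
  exact EnrichedModel.isContractible_of_zigzag
    (EnrichedModel.Factorization.replacement hM.pushoutProduct hproj)
    (EnrichedModel.Factorization.standard hM.pushoutProduct hproj γ)
    (EnrichedModel.Factorization.replacementTo hM.pushoutProduct hproj)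
    (EnrichedModel.Factorization.replacementToStandard hM.pushoutProduct hproj γ)
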